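/- Let $\mathbf{A}$ be an additive category. Its Freyd category $\mathcal{A}(\mathbf{A})$ has as objects the morphisms $(a \xleftarrow{\rho} r)$ of $\mathbf{A}$; a morphism $(a \xleftarrow{\rho} r)\to(a' \xleftarrow{\rho'} r')$ is a morphism $\alpha:a\to a'$ such that $\alpha\rho=\rho'\omega$ for some $\omega:r\to r'$, where $\alpha,\alpha'$ are identified if $\alpha-\alpha'=\rho'\lambda$ for some $\lambda:a\to r'$; composition and addition come from $\mathbf{A}$. Then $\mathcal{A}(\mathbf{A})$ is additive with cokernels, and $a\mapsto(a\leftarrow 0)$ embeds $\mathbf{A}$ in it. A bilinear functor is called right exact if it preserves cokernels in each variable. Let $T:\mathbf{A}\times\mathbf{A}\to\mathcal{A}(\mathbf{A})$ be a bilinear functor, and let $\otimes:\mathcal{A}(\mathbf{A})\times\mathcal{A}(\mathbf{A})\to\mathcal{A}(\mathbf{A})$ be its extension $$(a\leftarrow r_a)\otimes(b\leftarrow r_b)=\mathrm{coker}\bigl(T(r_a,b)\oplus T(a,r_b)\to T(a,b)\bigr).$$ (1) The functor $\otimes$ is bilinear and right exact, and its restriction to $\mathbf{A}\times\mathbf{A}$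 is isomorphic to $T$. (2) Let $1\in\mathcal{A}(\mathbf{A})$. All natural transformations $\alpha_{a,b,c}:a\otimes(b\otimes c)\to(a\otimes b)\otimes c$, $\lambda_a:1\otimes a\to a$, $\rho_a:a\otimes 1\to a$, $\gamma_{a,b}:a\otimes b\to b\otimes a$, natural in objects $a,b,c$ of $\mathbf{A}$, extend uniquely to natural transformations $\hat\alpha,\hat\lambda,\hat\rho,\hat\gamma$ of the same form, natural in objects of $\mathcal{A}(\mathbf{A})$; here $\hat\alpha_{A,B,C}$ is induced on cokernels by $\alpha_{a,b,c}$ when $A=(a\leftarrow r_a)$, $B=(b\leftarrow r_b)$, $C=(c\leftarrow r_c)$, and similarly for the others. Each of $\hat\alpha,\hat\lambda,\hat\rho,\hat\gamma$ is an isomorphism at all objects of $\mathcal{A}(\mathbf{A})$ if and only if $\alpha,\lambda,\rho,\gamma$, respectively, is an isomorphism at all objects of $\mathbf{A}$. (3) Each of the following identities holds for all objects of $\mathcal{A}(\mathbf{A})$ if and only if it holds for all objects $A,B,C,D$ in $\mathbf{A}$ (in the hexagons, $\alpha$ is assumed to be an isomorphism): - pentagon: $(\hat\alpha_{A,B,C}\otimes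 D)\circ\hat\alpha_{A,B\otimes C,D}\circ(A\otimes\hat\alpha_{B,C,D})=\hat\alpha_{A\otimes B,C,D}\circ\hat\alpha_{A,B,C\otimes D}$; - triangle: $(\hat\rho_A\otimes B)\circ\hat\alpha_{A,1,B}=A\otimes\hat\lambda_B$; - unit compatibility of the braiding: $\hat\lambda_A\circ\hat\gamma_{A,1}=\hat\rho_A$; - hexagon I: $\hat\alpha_{C,A,B}\circ\hat\gamma_{A\otimes B,C}=(\hat\gamma_{A,C}\otimes B)\circ\hat\alpha_{A,C,B}\circ(A\otimes\hat\gamma_{B,C})\circ\hat\alpha^{-1}_{A,B,C}$; - hexagon II: $\hat\alpha^{-1}_{B,C,A}\circ\hat\gamma_{A,B\otimes C}=(B\otimes\hat\gamma_{A,C})\circ\hat\alpha^{-1}_{B,A,C}\circ(\hat\gamma_{A,B}\otimes C)\circ\hat\alpha_{A,B,C}$; - symmetry: $\hat\gamma_{B,A}\circ\hat\gamma_{A,B}=\mathrm{id}_{A\otimes B}$. The same equivalence holds for the variants of the hexagons in which the last edge is reversed: $(\hat\gamma_{C,A}\otimes B)\circ\hat\alpha_{C,A,B}\circ\hat\gamma_{A\otimes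 B,C}=\hat\alpha_{A,C,B}\circ(A\otimes\hat\gamma_{B,C})\circ\hat\alpha^{-1}_{A,B,C}$ and $(B\otimes\hat\gamma_{C,A})\circ\hat\alpha^{-1}_{B,C,A}\circ\hat\gamma_{A,B\otimes C}=\hat\alpha^{-1}_{B,A,C}\circ(\hat\gamma_{A,B}\otimes C)\circ\hat\alpha_{A,B,C}$. (4) An f.p. promonoidal structure on $\mathbf{A}$ consists of a bilinear functor $T$, an object $1\in\mathcal{A}(\mathbf{A})$ and natural isomorphisms $\alpha,\lambda,\rho$ as above such that the pentagon and triangle identities hold at all objects of $\mathbf{A}$. Then $\otimes,1,\hat\alpha,\hat\lambda,\hat\rho$ make $\mathcal{A}(\mathbf{A})$ a monoidal category whose tensor product is additive and right exact in each variable. If moreover $\gamma$ is a natural isomorphism as above such that the unit compatibility and hexagons I and II hold at all objects of $\mathbf{A}$, then $\hat\gamma$ makes it a braided monoidal category, which is symmetric if $\gamma_{b,a}\circ\gamma_{a,b}=\mathrm{id}_{a\otimes b}$ for all $a,b\in\mathbf{A}$. -/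

import Mathlib

open CategoryTheory CategoryTheory.Limits

set_option linter.unusedSectionVars false

universe v u v₁ u₁ v₂ u₂ v₃ u₃

noncomputable section

/-- Objects of the Freyd category of `A`: morphisms `gen ⟵ rel` of `A`. -/
structure Freyd (A : Type u) [Category.{v} A] where
  gen : A
  rel : A
  ρ : rel ⟶ gen

namespace Freyd

variable {A : Type u} [Category.{v} A] [Preadditive A]

/-- The morphism data from `X` to `Y`: the morphisms `α : X.gen ⟶ Y.gen` that admit a
morphism witness `ω : X.rel ⟶ Y.rel`. -/
def homData (X Y : Freyd A) : AddSubgroup (X.gen ⟶ Y.gen) where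
  carrier := {α | ∃ ω : X.rel ⟶ Y.rel, X.ρ ≫ α = ω ≫ Y.ρ}
  zero_mem' := ⟨0, by simp⟩
  add_mem' := by
    rintro α β ⟨ω, h⟩ ⟨ω', h'⟩
    exact ⟨ω + ω', by simp [h, h']⟩
  neg_mem' := by
    rintro α ⟨ω, h⟩
    exact ⟨-ω, by simp [h]⟩

/-- The morphism data that are identified with zero: those of the form `lam ≫ Y.ρ`. -/
def nullData (X Y : Freyd A) : AddSubgroup (homData X Y) where
  carrier := {α | ∃ lam : X.gen ⟶ Y.rel, α.1 = lam ≫ Y.ρ}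
  zero_mem' := ⟨0, by simp⟩
  add_mem' := by
    rintro α β ⟨ω, h⟩ ⟨ω', h'⟩
    exact ⟨ω + ω', by simp [h, h']⟩
  neg_mem' := by
    rintro α ⟨ω, h⟩
    exact ⟨-ω, by simp [h]⟩

instance : CategoryStruct (Freyd A) where
  Hom X Y := homData X Y ⧸ nullData X Y
  id X := QuotientAddGroup.mk ⟨𝟙 X.gen, 𝟙 X.rel, by simp⟩
  comp {X Y Z} := Quotient.map₂
    (fun α β => ⟨α.1 ≫ β.1, by
      obtain ⟨α, ω, h⟩ := α
      obtain ⟨β, ω', h'⟩ := β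
      exact ⟨ω ≫ ω', by simp [reassoc_of% h, h']⟩⟩)
    (by
      rintro ⟨α, hα⟩ ⟨α', hα'⟩ h ⟨β, ω, hβ⟩ ⟨β', hβ'⟩ h'
      obtain ⟨l, hl⟩ := QuotientAddGroup.leftRel_apply.1 h
      obtain ⟨l', hl'⟩ := QuotientAddGroup.leftRel_apply.1 h'
      refine QuotientAddGroup.leftRel_apply.2 ⟨l ≫ ω + α' ≫ l', ?_⟩
      have e1 : α' = α + l ≫ Y.ρ := by
        rw [← hl]; simp
      have e2 : β' = β + l' ≫ Z.ρ := by
        rw [← hl']; simp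
      simp only [AddSubgroup.coe_add, AddSubgroup.coe_neg, e2, Preadditive.add_comp,
        Preadditive.comp_add, Category.assoc]
      rw [e1]
      simp [hβ]
      abel)

/-- The Freyd category; composition and identities are inherited from `A`. -/
instance : Category (Freyd A) where
  id_comp f := by
    obtain ⟨⟨α, h⟩, rfl⟩ := QuotientAddGroup.mk_surjective f
    exact congrArg QuotientAddGroup.mk (Subtype.ext (Category.id_comp α))
  comp_id f := by
    obtain ⟨⟨α, h⟩, rfl⟩ := QuotientAddGroup.mk_surjective f
    exact congrArg QuotientAddGroup.mk (Subtype.ext (Category.comp_id α))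
  assoc f g h := by
    obtain ⟨⟨α, _⟩, rfl⟩ := QuotientAddGroup.mk_surjective f
    obtain ⟨⟨β, _⟩, rfl⟩ := QuotientAddGroup.mk_surjective g
    obtain ⟨⟨γ, _⟩, rfl⟩ := QuotientAddGroup.mk_surjective h
    exact congrArg QuotientAddGroup.mk (Subtype.ext (Category.assoc α β γ))

/-- The morphism `{α}` of the Freyd category with morphism datum `α`. -/
def homMk {X Y : Freyd A} (α : X.gen ⟶ Y.gen)
    (h : ∃ ω : X.rel ⟶ Y.rel, X.ρ ≫ α = ω ≫ Y.ρ) : X ⟶ Y :=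
  QuotientAddGroup.mk (⟨α, h⟩ : homData X Y)

lemma homMk_surj {X Y : Freyd A} (f : X ⟶ Y) : ∃ α h, f = homMk α h := by
  obtain ⟨⟨α, h⟩, rfl⟩ := QuotientAddGroup.mk_surjective f
  exact ⟨α, h, rfl⟩

lemma homMk_eq_iff {X Y : Freyd A} {α β : X.gen ⟶ Y.gen} {hα hβ} :
    (homMk α hα : X ⟶ Y) = homMk β hβ ↔ ∃ lam : X.gen ⟶ Y.rel, α - β = lam ≫ Y.ρ := by
  refine QuotientAddGroup.eq_iff_sub_mem.trans ?_
  rfl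

lemma homMk_comp {X Y Z : Freyd A} (α : X.gen ⟶ Y.gen) (β : Y.gen ⟶ Z.gen) (hα hβ) :
    (homMk α hα : X ⟶ Y) ≫ (homMk β hβ : Y ⟶ Z) = homMk (α ≫ β) (by
      obtain ⟨ω, h⟩ := hα
      obtain ⟨ω', h'⟩ := hβ
      exact ⟨ω ≫ ω', by rw [reassoc_of% h, h', Category.assoc]⟩) := rfl

lemma id_eq (X : Freyd A) : 𝟙 X = homMk (𝟙 X.gen) ⟨𝟙 X.rel, by simp⟩ := rfl

instance (X Y : Freyd A) : AddCommGroup (X ⟶ Y) :=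
  inferInstanceAs (AddCommGroup (homData X Y ⧸ nullData X Y))

lemma homMk_add {X Y : Freyd A} (α β : X.gen ⟶ Y.gen) (hα hβ) :
    (homMk α hα : X ⟶ Y) + homMk β hβ = homMk (α + β) (by
      obtain ⟨ω, h⟩ := hα
      obtain ⟨ω', h'⟩ := hβ
      exact ⟨ω + ω', by simp [h, h']⟩) := rfl

lemma homMk_eq_zero_iff {X Y : Freyd A} {α : X.gen ⟶ Y.gen} {hα} :
    (homMk α hα : X ⟶ Y) = 0 ↔ ∃ lam : X.gen ⟶ Y.rel, α = lam ≫ Y.ρ := by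
  have : (0 : X ⟶ Y) = homMk 0 ⟨0, by simp⟩ := rfl
  rw [this, homMk_eq_iff]
  simp

instance : Preadditive (Freyd A) where
  add_comp X Y Z f g h := by
    obtain ⟨α, _, rfl⟩ := homMk_surj f
    obtain ⟨β, _, rfl⟩ := homMk_surj g
    obtain ⟨γ, _, rfl⟩ := homMk_surj h
    simp [homMk_comp, homMk_add]
  comp_add X Y Z f g h := by
    obtain ⟨α, _, rfl⟩ := homMk_surj f
    obtain ⟨β, _, rfl⟩ := homMk_surj g
    obtain ⟨γ, _, rfl⟩ := homMk_surj h
    simp [homMk_comp, homMk_add]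

variable [HasBinaryBiproducts A]

/-- The cokernel of `{α} : X ⟶ Y` is `(Y.gen ⟵ Y.rel ⊞ X.gen)`. -/
def cokerObj {X Y : Freyd A} (α : X.gen ⟶ Y.gen) : Freyd A where
  gen := Y.gen
  rel := Y.rel ⊞ X.gen
  ρ := biprod.desc Y.ρ α

def cokerπ {X Y : Freyd A} (α : X.gen ⟶ Y.gen) : Y ⟶ cokerObj α :=
  homMk (𝟙 Y.gen) ⟨biprod.inl, by simp [cokerObj]⟩

lemma comp_cokerπ {X Y : Freyd A} (α : X.gen ⟶ Y.gen) (hα) :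
    (homMk α hα : X ⟶ Y) ≫ cokerπ α = 0 := by
  refine homMk_eq_zero_iff.2 ⟨biprod.inr, ?_⟩
  simp [cokerObj]

instance epi_cokerπ {X Y : Freyd A} (α : X.gen ⟶ Y.gen) : Epi (cokerπ α) := by
  rw [Preadditive.epi_iff_cancel_zero]
  intro Z f hf
  obtain ⟨β, hβ, rfl⟩ := homMk_surj f
  obtain ⟨l, hl⟩ := homMk_eq_zero_iff.1 hf
  exact homMk_eq_zero_iff.2 ⟨l, (Category.id_comp β).symm.trans hl⟩

lemma cokerπ_desc {X Y Z : Freyd A} (α : X.gen ⟶ Y.gen) (hα) (k : Y ⟶ Z)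
    (hk : (homMk α hα : X ⟶ Y) ≫ k = 0) : ∃ m, cokerπ α ≫ m = k := by
  obtain ⟨β, ⟨ω, hβ⟩, rfl⟩ := homMk_surj k
  obtain ⟨l, hl⟩ := homMk_eq_zero_iff.1 hk
  refine ⟨homMk β ⟨biprod.desc ω l, ?_⟩, ?_⟩
  · apply biprod.hom_ext' <;> simp [cokerObj, hβ, hl]
  · exact congrArg QuotientAddGroup.mk (Subtype.ext (Category.id_comp β))

/-- The explicit cokernel has the universal property of the cokernel. -/
def cokerIsColimit {X Y : Freyd A} (α : X.gen ⟶ Y.gen) (hα) :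
    IsColimit (CokernelCofork.ofπ (cokerπ α) (comp_cokerπ α hα)) :=
  CokernelCofork.IsColimit.ofπ _ _
    (fun k hk => (cokerπ_desc α hα k hk).choose)
    (fun k hk => (cokerπ_desc α hα k hk).choose_spec)
    (fun k hk m hm => by
      rw [← cancel_epi (cokerπ α), hm, (cokerπ_desc α hα k hk).choose_spec])

instance : HasCokernels (Freyd A) where
  has_colimit f := by
    obtain ⟨α, hα, rfl⟩ := homMk_surj f
    exact ⟨⟨⟨_, cokerIsColimit α hα⟩⟩⟩

instance : HasBinaryBiproducts (Freyd A) where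
  has_binary_biproduct X Y := by
    let Z : Freyd A := ⟨X.gen ⊞ Y.gen, X.rel ⊞ Y.rel, biprod.map X.ρ Y.ρ⟩
    refine hasBinaryBiproduct_of_total
      { pt := Z
        fst := homMk (X := Z) biprod.fst ⟨biprod.fst, by simp [Z]⟩
        snd := homMk (X := Z) biprod.snd ⟨biprod.snd, by simp [Z]⟩
        inl := homMk (Y := Z) biprod.inl ⟨biprod.inl, by simp [Z]⟩
        inr := homMk (Y := Z) biprod.inr ⟨biprod.inr, by simp [Z]⟩
        inl_fst := by simp [homMk_comp, id_eq]
        inl_snd := homMk_eq_zero_iff.2 ⟨0, by simp⟩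
        inr_fst := homMk_eq_zero_iff.2 ⟨0, by simp⟩
        inr_snd := by simp [homMk_comp, id_eq] } ?_
    simp [homMk_comp, homMk_add, id_eq, Z, biprod.total]

variable [HasZeroObject A]

open ZeroObject in
instance : HasZeroObject (Freyd A) where
  zero := by
    refine ⟨⟨(0 : A), (0 : A), 0⟩, (IsZero.iff_id_eq_zero _).2 ?_⟩
    exact homMk_eq_zero_iff.2 ⟨0, (isZero_zero A).eq_of_src _ _⟩

open ZeroObject in
/-- The embedding `a ↦ (a ⟵ 0)`. -/
def emb : A ⥤ Freyd A where
  obj a := ⟨a, 0, 0⟩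
  map f := homMk f ⟨0, by simp⟩
  map_id a := rfl
  map_comp f g := rfl

open ZeroObject in
instance : (emb : A ⥤ Freyd A).Additive where

/-- The canonical projection from (the generators of) `X`. -/
def proj (X : Freyd A) : emb.obj X.gen ⟶ X :=
  homMk (X := emb.obj X.gen) (𝟙 X.gen) ⟨0, (isZero_zero A).eq_of_src _ _⟩


instance epi_proj (X : Freyd A) : Epi (proj X) := by
  rw [Preadditive.epi_iff_cancel_zero]
  intro Z f hf
  obtain ⟨β, hβ, rfl⟩ := homMk_surj f
  obtain ⟨l, hl⟩ := homMk_eq_zero_iff.1 hf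
  exact homMk_eq_zero_iff.2 ⟨l, (Category.id_comp β).symm.trans hl⟩

lemma emb_comp_proj (X : Freyd A) : emb.map X.ρ ≫ proj X = 0 :=
  homMk_eq_zero_iff.2 ⟨𝟙 _, (Category.comp_id _).trans (Category.id_comp _).symm⟩

lemma proj_desc (X : Freyd A) {Z : Freyd A} (k : emb.obj X.gen ⟶ Z)
    (hk : emb.map X.ρ ≫ k = 0) : ∃ m, proj X ≫ m = k := by
  obtain ⟨β, hβ, rfl⟩ := homMk_surj k
  obtain ⟨l, hl⟩ := homMk_eq_zero_iff.1 hk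
  exact ⟨homMk β ⟨l, hl⟩, congrArg QuotientAddGroup.mk (Subtype.ext (Category.id_comp β))⟩

/-- Every object `X` is the cokernel of `emb X.rel ⟶ emb X.gen`. -/
def projIsColimit (X : Freyd A) :
    IsColimit (CokernelCofork.ofπ (proj X) (emb_comp_proj X)) :=
  CokernelCofork.IsColimit.ofπ _ _
    (fun k hk => (proj_desc X k hk).choose)
    (fun k hk => (proj_desc X k hk).choose_spec)
    (fun k hk m hm => by
      rw [← cancel_epi (proj X), hm, (proj_desc X k hk).choose_spec])

lemma exists_proj_comp {X Y : Freyd A} (f : X ⟶ Y) :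
    ∃ φ : X.gen ⟶ Y.gen, proj X ≫ f = emb.map φ ≫ proj Y := by
  obtain ⟨α, hα, rfl⟩ := homMk_surj f
  exact ⟨α, congrArg QuotientAddGroup.mk (Subtype.ext
    ((Category.id_comp α).trans (Category.comp_id α).symm))⟩

end Freyd

section Multilinear

open CategoryTheory.Prod

variable {C₁ : Type u₁} [Category.{v₁} C₁] [Preadditive C₁]
  {C₂ : Type u₂} [Category.{v₂} C₂] [Preadditive C₂]
  {C₃ : Type u₃} [Category.{v₃} C₃] [Preadditive C₃]
  {D : Type u} [Category.{v} D] [Preadditive D]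

/-- Additive functors that preserve all existing cokernels. -/
class IsRightExact (F : C₁ ⥤ D) : Prop where
  additive : F.Additive
  preserves : ∀ {X Y : C₁} (f : X ⟶ Y), PreservesColimit (parallelPair f 0) F

/-- Bilinear functors: componentwise additive. -/
class IsBilinear (F : C₁ × C₂ ⥤ D) : Prop where
  left : ∀ Y : C₂, (Prod.sectL C₁ Y ⋙ F).Additive
  right : ∀ X : C₁, (Prod.sectR X C₂ ⋙ F).Additive

/-- Right exact bilinear functors: componentwise right exact. -/
class IsRightExact₂ (F : C₁ × C₂ ⥤ D) : Prop where
  left : ∀ Y : C₂, IsRightExact (Prod.sectL C₁ Y ⋙ F)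
  right : ∀ X : C₁, IsRightExact (Prod.sectR X C₂ ⋙ F)

/-- Right exact trilinear functors: componentwise right exact. -/
class IsRightExact₃ (F : C₁ × C₂ × C₃ ⥤ D) : Prop where
  fst : ∀ (Y : C₂) (Z : C₃), IsRightExact (Prod.sectL C₁ (Y, Z) ⋙ F)
  snd : ∀ (X : C₁) (Z : C₃), IsRightExact (Prod.sectL C₂ Z ⋙ Prod.sectR X (C₂ × C₃) ⋙ F)
  thd : ∀ (X : C₁) (Y : C₂), IsRightExact (Prod.sectR Y C₃ ⋙ Prod.sectR X (C₂ × C₃) ⋙ F)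

lemma map_mkHom_comp (F : C₁ × C₂ ⥤ D) {X X' X'' : C₁} {Y Y' Y'' : C₂} (f : X ⟶ X')
    (f' : X' ⟶ X'') (g : Y ⟶ Y') (g' : Y' ⟶ Y'') :
    F.map (f ×ₘ g) ≫ F.map (f' ×ₘ g') = F.map ((f ≫ f') ×ₘ (g ≫ g')) :=
  (F.map_comp (f ×ₘ g) (f' ×ₘ g')).symm

lemma map_mkHom_id (F : C₁ × C₂ ⥤ D) (X : C₁) (Y : C₂) : F.map (𝟙 X ×ₘ 𝟙 Y) = 𝟙 _ :=
  F.map_id (X, Y)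

namespace IsBilinear

variable (F : C₁ × C₂ ⥤ D) [IsBilinear F]

lemma map_add_left {X X' : C₁} (f g : X ⟶ X') (Y : C₂) :
    F.map ((f + g) ×ₘ 𝟙 Y) = F.map (f ×ₘ 𝟙 Y) + F.map (g ×ₘ 𝟙 Y) :=
  have := left (F := F) Y
  (Prod.sectL C₁ Y ⋙ F).map_add

lemma map_add_right (X : C₁) {Y Y' : C₂} (f g : Y ⟶ Y') :
    F.map (𝟙 X ×ₘ (f + g)) = F.map (𝟙 X ×ₘ f) + F.map (𝟙 X ×ₘ g) :=
  have := right (F := F) X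
  (Prod.sectR X C₂ ⋙ F).map_add

lemma map_sub_left {X X' : C₁} (f g : X ⟶ X') (Y : C₂) :
    F.map ((f - g) ×ₘ 𝟙 Y) = F.map (f ×ₘ 𝟙 Y) - F.map (g ×ₘ 𝟙 Y) :=
  have := left (F := F) Y
  (Prod.sectL C₁ Y ⋙ F).map_sub

lemma map_sub_right (X : C₁) {Y Y' : C₂} (f g : Y ⟶ Y') :
    F.map (𝟙 X ×ₘ (f - g)) = F.map (𝟙 X ×ₘ f) - F.map (𝟙 X ×ₘ g) :=
  have := right (F := F) X
  (Prod.sectR X C₂ ⋙ F).map_sub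

lemma biprod_left [HasBinaryBiproducts C₁] {X X' : C₁} {Y : C₂} {Z : D}
    (k : F.obj (X ⊞ X', Y) ⟶ Z) (h : F.map (biprod.inl ×ₘ 𝟙 Y) ≫ k = 0)
    (h' : F.map (biprod.inr ×ₘ 𝟙 Y) ≫ k = 0) : k = 0 := by
  have e : (𝟙 (F.obj (X ⊞ X', Y))) = F.map (biprod.fst ×ₘ 𝟙 Y) ≫ F.map (biprod.inl ×ₘ 𝟙 Y) +
      F.map (biprod.snd ×ₘ 𝟙 Y) ≫ F.map (biprod.inr ×ₘ 𝟙 Y) := by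
    rw [map_mkHom_comp, map_mkHom_comp, Category.comp_id, ← map_add_left, biprod.total,
      map_mkHom_id]
  rw [← Category.id_comp k, e, Preadditive.add_comp, Category.assoc, Category.assoc, h, h']
  simp

lemma biprod_right [HasBinaryBiproducts C₂] {X : C₁} {Y Y' : C₂} {Z : D}
    (k : F.obj (X, Y ⊞ Y') ⟶ Z) (h : F.map (𝟙 X ×ₘ biprod.inl) ≫ k = 0)
    (h' : F.map (𝟙 X ×ₘ biprod.inr) ≫ k = 0) : k = 0 := by
  have e : (𝟙 (F.obj (X, Y ⊞ Y'))) = F.map (𝟙 X ×ₘ biprod.fst) ≫ F.map (𝟙 X ×ₘ biprod.inl) +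
      F.map (𝟙 X ×ₘ biprod.snd) ≫ F.map (𝟙 X ×ₘ biprod.inr) := by
    rw [map_mkHom_comp, map_mkHom_comp, Category.comp_id, ← map_add_right, biprod.total,
      map_mkHom_id]
  rw [← Category.id_comp k, e, Preadditive.add_comp, Category.assoc, Category.assoc, h, h']
  simp

lemma biprod_desc_left [HasBinaryBiproducts C₁] {X X' X'' : C₁} {Y : C₂} {Z : D}
    {u : X ⟶ X''} {w : X' ⟶ X''} (k : F.obj (X'', Y) ⟶ Z) (h : F.map (u ×ₘ 𝟙 Y) ≫ k = 0)
    (h' : F.map (w ×ₘ 𝟙 Y) ≫ k = 0) : F.map (biprod.desc u w ×ₘ 𝟙 Y) ≫ k = 0 := by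
  apply biprod_left F
  · rwa [← Category.assoc, map_mkHom_comp, biprod.inl_desc, Category.comp_id]
  · rwa [← Category.assoc, map_mkHom_comp, biprod.inr_desc, Category.comp_id]

lemma biprod_desc_right [HasBinaryBiproducts C₂] {X : C₁} {Y Y' Y'' : C₂} {Z : D}
    {u : Y ⟶ Y''} {w : Y' ⟶ Y''} (k : F.obj (X, Y'') ⟶ Z) (h : F.map (𝟙 X ×ₘ u) ≫ k = 0)
    (h' : F.map (𝟙 X ×ₘ w) ≫ k = 0) : F.map (𝟙 X ×ₘ biprod.desc u w) ≫ k = 0 := by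
  apply biprod_right F
  · rwa [← Category.assoc, map_mkHom_comp, biprod.inl_desc, Category.comp_id]
  · rwa [← Category.assoc, map_mkHom_comp, biprod.inr_desc, Category.comp_id]

end IsBilinear

lemma preservesColimit_of_desc (G : C₁ ⥤ D) [G.Additive] {X Y Q : C₁} {f : X ⟶ Y} {p : Y ⟶ Q}
    (w : f ≫ p = 0) (hp : IsColimit (CokernelCofork.ofπ p w)) [Epi (G.map p)]
    (desc : ∀ {Z : D} (k : G.obj Y ⟶ Z), G.map f ≫ k = 0 → ∃ m, G.map p ≫ m = k) :
    PreservesColimit (parallelPair f 0) G :=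
  preservesColimit_of_preserves_colimit_cocone hp
    ((isColimitMapCoconeCoforkEquiv' G w).symm
      (CokernelCofork.IsColimit.ofπ _ _
        (fun k hk => (desc k hk).choose)
        (fun k hk => (desc k hk).choose_spec)
        (fun k hk m hm => by
          rw [← cancel_epi (G.map p), hm, (desc k hk).choose_spec])))

lemma IsRightExact.desc (G : C₁ ⥤ D) [h : IsRightExact G] {X Y Q : C₁} {f : X ⟶ Y} {p : Y ⟶ Q}
    (w : f ≫ p = 0) (hp : IsColimit (CokernelCofork.ofπ p w)) :
    Epi (G.map p) ∧
      ∀ {Z : D} (k : G.obj Y ⟶ Z), G.map f ≫ k = 0 → ∃ m, G.map p ≫ m = k := by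
  have := h.additive
  have := h.preserves f
  have hc := isColimitCoforkMapOfIsColimit' G w hp
  refine ⟨Cofork.IsColimit.epi hc, fun k hk => ?_⟩
  exact ⟨_, (CokernelCofork.IsColimit.desc' hc k hk).2⟩

lemma IsRightExact.of_iso {F G : C₁ ⥤ D} (e : F ≅ G) [h : IsRightExact F] : IsRightExact G where
  additive := by
    have := h.additive
    exact Functor.additive_of_iso e
  preserves f :=
    have := h.preserves f
    preservesColimit_of_natIso _ e

lemma IsRightExact.comp (F : C₁ ⥤ C₂) (G : C₂ ⥤ D) [hF : IsRightExact F] [hG : IsRightExact G] :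
    IsRightExact (F ⋙ G) where
  additive := by
    have := hF.additive
    have := hG.additive
    infer_instance
  preserves {X Y} f := by
    have := hF.additive
    have := hF.preserves f
    have := hG.preserves (F.map f)
    have : PreservesColimit (parallelPair f 0 ⋙ F) G :=
      preservesColimit_of_iso_diagram G
        (parallelPair.ext (Iso.refl _) (Iso.refl _) (by simp) (by simp) :
          parallelPair (F.map f) 0 ≅ parallelPair f 0 ⋙ F)
    infer_instance

end Multilinear

namespace Freyd

open CategoryTheory.Prod

variable {A : Type u} [Category.{v} A] [Preadditive A] [HasZeroObject A] [HasBinaryBiproducts A]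
  {B : Type u₁} [Category.{v₁} B] [Preadditive B] [HasBinaryBiproducts B] [HasCokernels B]

section Extension

variable (F : A × A ⥤ B)

/-- The relations `F (r_X, y) ⊞ F (x, r_Y) ⟶ F (x, y)` for `X = (x ⟵ r_X)`, `Y = (y ⟵ r_Y)`. -/
def extRel (X Y : Freyd A) :
    F.obj (X.rel, Y.gen) ⊞ F.obj (X.gen, Y.rel) ⟶ F.obj (X.gen, Y.gen) :=
  biprod.desc (F.map (X.ρ ×ₘ 𝟙 Y.gen)) (F.map (𝟙 X.gen ×ₘ Y.ρ))

/-- The projection of `F (x, y)` onto the cokernel of the relations. -/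
def extπ (X Y : Freyd A) : F.obj (X.gen, Y.gen) ⟶ cokernel (extRel F X Y) :=
  cokernel.π (extRel F X Y)

instance (X Y : Freyd A) : Epi (extπ F X Y) :=
  inferInstanceAs (Epi (cokernel.π (extRel F X Y)))

lemma map_left_extπ (X Y : Freyd A) : F.map (X.ρ ×ₘ 𝟙 Y.gen) ≫ extπ F X Y = 0 := by
  have := biprod.inl ≫= cokernel.condition (extRel F X Y)
  simpa [extRel, extπ] using this.trans comp_zero

lemma map_right_extπ (X Y : Freyd A) : F.map (𝟙 X.gen ×ₘ Y.ρ) ≫ extπ F X Y = 0 := by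
  have := biprod.inr ≫= cokernel.condition (extRel F X Y)
  simpa [extRel, extπ] using this.trans comp_zero

lemma extπ_desc {X Y : Freyd A} {Z : B} (k : F.obj (X.gen, Y.gen) ⟶ Z)
    (h : F.map (X.ρ ×ₘ 𝟙 Y.gen) ≫ k = 0) (h' : F.map (𝟙 X.gen ×ₘ Y.ρ) ≫ k = 0) :
    ∃ m, extπ F X Y ≫ m = k :=
  ⟨cokernel.desc (extRel F X Y) k (by
    apply biprod.hom_ext' <;> simp [extRel, h, h']), cokernel.π_desc _ _ _⟩

variable [IsBilinear F]

lemma ext_map_eq {X X' Y Y' : Freyd A} {α α' : X.gen ⟶ X'.gen} {β β' : Y.gen ⟶ Y'.gen}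
    (hα : ∃ l : X.gen ⟶ X'.rel, α - α' = l ≫ X'.ρ) (hβ : ∃ l : Y.gen ⟶ Y'.rel, β - β' = l ≫ Y'.ρ) :
    F.map (α ×ₘ β) ≫ extπ F X' Y' = F.map (α' ×ₘ β') ≫ extπ F X' Y' := by
  obtain ⟨l, hl⟩ := hα
  obtain ⟨l', hl'⟩ := hβ
  have e1 : F.map (α ×ₘ β) ≫ extπ F X' Y' = F.map (α' ×ₘ β) ≫ extπ F X' Y' := by
    have : F.map ((α - α') ×ₘ 𝟙 Y.gen) ≫ F.map (𝟙 X'.gen ×ₘ β) ≫ extπ F X' Y' = 0 := by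
      rw [hl, ← Category.comp_id (𝟙 Y.gen), ← map_mkHom_comp F l X'.ρ, Category.assoc, ← Category.assoc (F.map (X'.ρ ×ₘ _)),
        map_mkHom_comp, Category.comp_id, Category.id_comp]
      have : F.map (X'.ρ ×ₘ β) = F.map (𝟙 X'.rel ×ₘ β) ≫ F.map (X'.ρ ×ₘ 𝟙 _) := by
        rw [map_mkHom_comp, Category.comp_id, Category.id_comp]
      rw [this, Category.assoc, map_left_extπ, comp_zero, comp_zero]
    rw [IsBilinear.map_sub_left, Preadditive.sub_comp, sub_eq_zero, ← Category.assoc,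
      ← Category.assoc, map_mkHom_comp, map_mkHom_comp] at this
    simpa using this
  rw [e1]
  have : F.map (α' ×ₘ 𝟙 Y.gen) ≫ F.map (𝟙 X'.gen ×ₘ (β - β')) ≫ extπ F X' Y' = 0 := by
    rw [hl', ← Category.comp_id (𝟙 X'.gen), ← map_mkHom_comp, Category.assoc, map_right_extπ,
      comp_zero, comp_zero]
  rw [IsBilinear.map_sub_right, Preadditive.sub_comp, Preadditive.comp_sub, sub_eq_zero,
    ← Category.assoc, ← Category.assoc, map_mkHom_comp, map_mkHom_comp] at this
  simpa using this

lemma ext_map_exists {X X' Y Y' : Freyd A} (f : X ⟶ X') (g : Y ⟶ Y') :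
    ∃ m : cokernel (extRel F X Y) ⟶ cokernel (extRel F X' Y'),
      ∀ (α : X.gen ⟶ X'.gen) (β : Y.gen ⟶ Y'.gen) (hα hβ), f = homMk α hα → g = homMk β hβ →
        extπ F X Y ≫ m = F.map (α ×ₘ β) ≫ extπ F X' Y' := by
  obtain ⟨α, ⟨ω, hα⟩, rfl⟩ := homMk_surj f
  obtain ⟨β, ⟨ω', hβ⟩, rfl⟩ := homMk_surj g
  obtain ⟨m, hm⟩ := extπ_desc F (X := X) (Y := Y) (F.map (α ×ₘ β) ≫ extπ F X' Y')
    (by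
      have : F.map (X.ρ ×ₘ 𝟙 Y.gen) ≫ F.map (α ×ₘ β) =
          F.map (ω ×ₘ β) ≫ F.map (X'.ρ ×ₘ 𝟙 Y'.gen) := by
        rw [map_mkHom_comp, map_mkHom_comp, hα, Category.comp_id, Category.id_comp]
      rw [← Category.assoc, this, Category.assoc, map_left_extπ, comp_zero])
    (by
      have : F.map (𝟙 X.gen ×ₘ Y.ρ) ≫ F.map (α ×ₘ β) =
          F.map (α ×ₘ ω') ≫ F.map (𝟙 X'.gen ×ₘ Y'.ρ) := by
        rw [map_mkHom_comp, map_mkHom_comp, hβ, Category.comp_id, Category.id_comp]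
      rw [← Category.assoc, this, Category.assoc, map_right_extπ, comp_zero])
  refine ⟨m, fun α' β' hα' hβ' e e' => hm.trans ?_⟩
  exact ext_map_eq F (homMk_eq_iff.1 e) (homMk_eq_iff.1 e')

/-- The action of the extension on morphisms: `extMap F {α} {β}` is the map induced on the
cokernels by `F (α, β)`. -/
def extMap {X X' Y Y' : Freyd A} (f : X ⟶ X') (g : Y ⟶ Y') :
    cokernel (extRel F X Y) ⟶ cokernel (extRel F X' Y') :=
  (ext_map_exists F f g).choose

lemma extπ_extMap {X X' Y Y' : Freyd A} (α : X.gen ⟶ X'.gen) (β : Y.gen ⟶ Y'.gen) (hα hβ) :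
    extπ F X Y ≫ extMap F (homMk α hα : X ⟶ X') (homMk β hβ : Y ⟶ Y') =
      F.map (α ×ₘ β) ≫ extπ F X' Y' :=
  (ext_map_exists F _ _).choose_spec α β hα hβ rfl rfl

/-- The extension of a bilinear functor `F : A × A ⥤ B` to the Freyd category:
`(X, Y)` is sent to the cokernel of `F (r_X, y) ⊞ F (x, r_Y) ⟶ F (x, y)`. -/
def extend₂ : Freyd A × Freyd A ⥤ B where
  obj X := cokernel (extRel F X.1 X.2)
  map f := extMap F f.1 f.2
  map_id X := by
    rw [← cancel_epi (extπ F X.1 X.2)]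
    refine (extπ_extMap F (𝟙 _) (𝟙 _) _ _).trans ?_
    rw [map_mkHom_id, Category.id_comp, Category.comp_id]
  map_comp {X Y Z} f g := by
    obtain ⟨f₁, f₂⟩ := f
    obtain ⟨g₁, g₂⟩ := g
    obtain ⟨α, hα, rfl⟩ := homMk_surj f₁
    obtain ⟨α', hα', rfl⟩ := homMk_surj f₂
    obtain ⟨β, hβ, rfl⟩ := homMk_surj g₁
    obtain ⟨β', hβ', rfl⟩ := homMk_surj g₂
    rw [← cancel_epi (extπ F X.1 X.2)]
    refine (extπ_extMap F (α ≫ β) (α' ≫ β') _ _).trans ?_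
    dsimp only
    rw [← Category.assoc, extπ_extMap, Category.assoc, extπ_extMap, ← Category.assoc,
      map_mkHom_comp]

/-- The canonical projection of `F (x, y)` onto the value of the extension at `(X, Y)`. -/
def genπ (X Y : Freyd A) : F.obj (X.gen, Y.gen) ⟶ (extend₂ F).obj (X, Y) :=
  extπ F X Y

instance epi_genπ (X Y : Freyd A) : Epi (genπ F X Y) :=
  inferInstanceAs (Epi (extπ F X Y))

lemma genπ_map {X X' Y Y' : Freyd A} (α : X.gen ⟶ X'.gen) (β : Y.gen ⟶ Y'.gen) (hα hβ) :
    genπ F X Y ≫ (extend₂ F).map ((homMk α hα : X ⟶ X') ×ₘ (homMk β hβ : Y ⟶ Y')) =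
      F.map (α ×ₘ β) ≫ genπ F X' Y' :=
  extπ_extMap F α β hα hβ

lemma genπ_map_left {X X' Y : Freyd A} (α : X.gen ⟶ X'.gen) (hα) :
    genπ F X Y ≫ (extend₂ F).map ((homMk α hα : X ⟶ X') ×ₘ 𝟙 Y) =
      F.map (α ×ₘ 𝟙 Y.gen) ≫ genπ F X' Y :=
  genπ_map F α (𝟙 _) hα ⟨𝟙 _, by simp⟩

lemma genπ_map_right {X Y Y' : Freyd A} (β : Y.gen ⟶ Y'.gen) (hβ) :
    genπ F X Y ≫ (extend₂ F).map (𝟙 X ×ₘ (homMk β hβ : Y ⟶ Y')) =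
      F.map (𝟙 X.gen ×ₘ β) ≫ genπ F X Y' :=
  genπ_map F (𝟙 _) β ⟨𝟙 _, by simp⟩ hβ

lemma genπ_desc {X Y : Freyd A} {Z : B} (k : F.obj (X.gen, Y.gen) ⟶ Z)
    (h : F.map (X.ρ ×ₘ 𝟙 Y.gen) ≫ k = 0) (h' : F.map (𝟙 X.gen ×ₘ Y.ρ) ≫ k = 0) :
    ∃ m, genπ F X Y ≫ m = k :=
  extπ_desc F k h h'

lemma extend₂_map_add_left {X X' : Freyd A} (f g : X ⟶ X') (Y : Freyd A) :
    (extend₂ F).map ((f + g) ×ₘ 𝟙 Y) =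
      (extend₂ F).map (f ×ₘ 𝟙 Y) + (extend₂ F).map (g ×ₘ 𝟙 Y) := by
  obtain ⟨α, hα, rfl⟩ := homMk_surj f
  obtain ⟨β, hβ, rfl⟩ := homMk_surj g
  rw [← cancel_epi (genπ F X Y), homMk_add, genπ_map_left, Preadditive.comp_add _ _ _ (genπ F X Y),
    genπ_map_left, genπ_map_left, IsBilinear.map_add_left, Preadditive.add_comp]

lemma extend₂_map_add_right (X : Freyd A) {Y Y' : Freyd A} (f g : Y ⟶ Y') :
    (extend₂ F).map (𝟙 X ×ₘ (f + g)) =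
      (extend₂ F).map (𝟙 X ×ₘ f) + (extend₂ F).map (𝟙 X ×ₘ g) := by
  obtain ⟨α, hα, rfl⟩ := homMk_surj f
  obtain ⟨β, hβ, rfl⟩ := homMk_surj g
  rw [← cancel_epi (genπ F X Y), homMk_add, genπ_map_right, Preadditive.comp_add _ _ _ (genπ F X Y),
    genπ_map_right, genπ_map_right, IsBilinear.map_add_right, Preadditive.add_comp]

lemma genπ_cokerπ_left {X X' : Freyd A} (α : X.gen ⟶ X'.gen) (Y : Freyd A) :
    genπ F X' Y ≫ (extend₂ F).map (cokerπ α ×ₘ 𝟙 Y) = genπ F (cokerObj α) Y := by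
  refine (genπ_map_left F (X' := cokerObj α) (𝟙 X'.gen) _).trans ?_
  exact (congrArg (· ≫ genπ F (cokerObj α) Y) (map_mkHom_id F X'.gen Y.gen)).trans
    (Category.id_comp (genπ F (cokerObj α) Y))

lemma genπ_cokerπ_right {X X' : Freyd A} (α : X.gen ⟶ X'.gen) (Y : Freyd A) :
    genπ F Y X' ≫ (extend₂ F).map (𝟙 Y ×ₘ cokerπ α) = genπ F Y (cokerObj α) := by
  refine (genπ_map_right F (Y' := cokerObj α) (𝟙 X'.gen) _).trans ?_
  exact (congrArg (· ≫ genπ F Y (cokerObj α)) (map_mkHom_id F Y.gen X'.gen)).trans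
    (Category.id_comp (genπ F Y (cokerObj α)))

lemma extend₂_desc_left {X X' : Freyd A} (α : X.gen ⟶ X'.gen) (hα) (Y : Freyd A) {Z : B}
    (k : (extend₂ F).obj (X', Y) ⟶ Z)
    (hk : (extend₂ F).map ((homMk α hα : X ⟶ X') ×ₘ 𝟙 Y) ≫ k = 0) :
    ∃ m, (extend₂ F).map (cokerπ α ×ₘ 𝟙 Y) ≫ m = k := by
  have h1 : F.map (α ×ₘ 𝟙 Y.gen) ≫ genπ F X' Y ≫ k = 0 := by
    rw [← Category.assoc, ← genπ_map_left F α hα, Category.assoc, hk, comp_zero]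
  have h2 : F.map (X'.ρ ×ₘ 𝟙 Y.gen) ≫ genπ F X' Y ≫ k = 0 := by
    rw [← Category.assoc]
    exact (congrArg (· ≫ k) (map_left_extπ F X' Y)).trans zero_comp
  have h3 : F.map (𝟙 X'.gen ×ₘ Y.ρ) ≫ genπ F X' Y ≫ k = 0 := by
    rw [← Category.assoc]
    exact (congrArg (· ≫ k) (map_right_extπ F X' Y)).trans zero_comp
  obtain ⟨m, hm⟩ := genπ_desc F (X := cokerObj α) (Y := Y) (genπ F X' Y ≫ k)
    (IsBilinear.biprod_desc_left F _ h2 h1) h3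
  refine ⟨m, ?_⟩
  rw [← cancel_epi (genπ F X' Y), ← Category.assoc, genπ_cokerπ_left]
  exact hm

lemma extend₂_desc_right {X X' : Freyd A} (α : X.gen ⟶ X'.gen) (hα) (Y : Freyd A) {Z : B}
    (k : (extend₂ F).obj (Y, X') ⟶ Z)
    (hk : (extend₂ F).map (𝟙 Y ×ₘ (homMk α hα : X ⟶ X')) ≫ k = 0) :
    ∃ m, (extend₂ F).map (𝟙 Y ×ₘ cokerπ α) ≫ m = k := by
  have h1 : F.map (𝟙 Y.gen ×ₘ α) ≫ genπ F Y X' ≫ k = 0 := by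
    rw [← Category.assoc, ← genπ_map_right F α hα, Category.assoc, hk, comp_zero]
  have h2 : F.map (𝟙 Y.gen ×ₘ X'.ρ) ≫ genπ F Y X' ≫ k = 0 := by
    rw [← Category.assoc]
    exact (congrArg (· ≫ k) (map_right_extπ F Y X')).trans zero_comp
  have h3 : F.map (Y.ρ ×ₘ 𝟙 X'.gen) ≫ genπ F Y X' ≫ k = 0 := by
    rw [← Category.assoc]
    exact (congrArg (· ≫ k) (map_left_extπ F Y X')).trans zero_comp
  obtain ⟨m, hm⟩ := genπ_desc F (X := Y) (Y := cokerObj α) (genπ F Y X' ≫ k) h3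
    (IsBilinear.biprod_desc_right F _ h2 h1)
  refine ⟨m, ?_⟩
  rw [← cancel_epi (genπ F Y X'), ← Category.assoc, genπ_cokerπ_right]
  exact hm

instance isBilinear_extend₂ : IsBilinear (extend₂ F) where
  left Y := ⟨fun {_ _ f g} => extend₂_map_add_left F f g Y⟩
  right X := ⟨fun {_ _ f g} => extend₂_map_add_right F X f g⟩

/-- The extension of a bilinear functor is right exact. -/
instance isRightExact_extend₂ : IsRightExact₂ (extend₂ F) where
  left Y := ⟨IsBilinear.left Y, fun f => by
    obtain ⟨α, hα, rfl⟩ := homMk_surj f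
    have := IsBilinear.left (F := extend₂ F) Y
    have : Epi ((Prod.sectL (Freyd A) Y ⋙ extend₂ F).map (cokerπ α)) :=
      @epi_of_epi_fac _ _ _ _ _ _ _ _ (epi_genπ F (cokerObj α) Y) (genπ_cokerπ_left F α Y)
    exact preservesColimit_of_desc _ (comp_cokerπ α hα) (cokerIsColimit α hα)
      (fun k hk => extend₂_desc_left F α hα Y k hk)⟩
  right Y := ⟨IsBilinear.right Y, fun f => by
    obtain ⟨α, hα, rfl⟩ := homMk_surj f
    have := IsBilinear.right (F := extend₂ F) Y
    have : Epi ((Prod.sectR Y (Freyd A) ⋙ extend₂ F).map (cokerπ α)) :=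
      @epi_of_epi_fac _ _ _ _ _ _ _ _ (epi_genπ F Y (cokerObj α)) (genπ_cokerπ_right F α Y)
    exact preservesColimit_of_desc _ (comp_cokerπ α hα) (cokerIsColimit α hα)
      (fun k hk => extend₂_desc_right F α hα Y k hk)⟩

end Extension

/-! Extension of natural transformations along `emb`. -/

section Presentation

universe v₄ u₄

variable {K : Type u₂} [Category.{v₂} K] {L : Type u₃} [Category.{v₃} L]
  {D : Type u₄} [Category.{v₄} D]

/-- A covering of each object `X` of `L` by an object `J (obj X)`, such that every morphism of `L`
lifts along the coverings. -/
structure Presentation (J : K ⥤ L) where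
  obj : L → K
  π : ∀ X : L, J.obj (obj X) ⟶ X
  exists_lift : ∀ {X Y : L} (f : X ⟶ Y), ∃ φ : obj X ⟶ obj Y, π X ≫ f = J.map φ ≫ π Y

/-- `F` maps each `π X` to an epimorphism through which every morphism factors that identifies
the (images under `F` of) pairs of morphisms identified by `π X`. -/
structure Presentation.Descends {J : K ⥤ L} (P : Presentation J) (F : L ⥤ D) : Prop where
  epi : ∀ X : L, Epi (F.map (P.π X))
  desc : ∀ {X : L} {Z : D} (k : F.obj (J.obj (P.obj X)) ⟶ Z),
    (∀ {W : K} (u w : W ⟶ P.obj X), J.map u ≫ P.π X = J.map w ≫ P.π X →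
      F.map (J.map u) ≫ k = F.map (J.map w) ≫ k) → ∃ m, F.map (P.π X) ≫ m = k

namespace Presentation

variable {J : K ⥤ L} (P : Presentation J) {F G : L ⥤ D} (hF : P.Descends F)

lemma extNat_exists (hF : P.Descends F) (α : J ⋙ F ⟶ J ⋙ G) (X : L) :
    ∃ m : F.obj X ⟶ G.obj X, F.map (P.π X) ≫ m = α.app (P.obj X) ≫ G.map (P.π X) := by
  refine hF.desc _ fun {W} u w h => ?_
  have hu := α.naturality u
  have hw := α.naturality w
  dsimp at hu hw
  rw [← Category.assoc, hu, Category.assoc, ← G.map_comp, h, G.map_comp, ← Category.assoc,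
    ← hw, Category.assoc]

/-- The extension of `α`, determined by `F (π X) ≫ extNat α X = α ≫ G (π X)`. -/
def extNat (α : J ⋙ F ⟶ J ⋙ G) : F ⟶ G where
  app X := (P.extNat_exists hF α X).choose
  naturality X Y f := by
    have := hF.epi X
    obtain ⟨φ, hφ⟩ := P.exists_lift f
    have hn := α.naturality φ
    dsimp at hn
    rw [← cancel_epi (F.map (P.π X)), ← Category.assoc, ← F.map_comp, hφ, F.map_comp,
      Category.assoc, (P.extNat_exists hF α Y).choose_spec, ← Category.assoc, hn,
      ← Category.assoc, (P.extNat_exists hF α X).choose_spec, Category.assoc, Category.assoc,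
      ← G.map_comp, ← G.map_comp, hφ]

lemma π_extNat (α : J ⋙ F ⟶ J ⋙ G) (X : L) :
    F.map (P.π X) ≫ (P.extNat hF α).app X = α.app (P.obj X) ≫ G.map (P.π X) :=
  (P.extNat_exists hF α X).choose_spec

lemma extNat_comp_eq_id (hG : P.Descends G) (α : J ⋙ F ⟶ J ⋙ G) (β : J ⋙ G ⟶ J ⋙ F)
    (h : α ≫ β = 𝟙 _) : P.extNat hF α ≫ P.extNat hG β = 𝟙 F := by
  ext X
  have := hF.epi X
  have e : α.app (P.obj X) ≫ β.app (P.obj X) = 𝟙 _ := congr_app h (P.obj X)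
  rw [← cancel_epi (F.map (P.π X)), NatTrans.comp_app, ← Category.assoc, π_extNat,
    Category.assoc, π_extNat, ← Category.assoc, e]
  simp

/-- The extension of a natural isomorphism. -/
def extIso (hG : P.Descends G) (e : J ⋙ F ≅ J ⋙ G) : F ≅ G where
  hom := P.extNat hF e.hom
  inv := P.extNat hG e.inv
  hom_inv_id := P.extNat_comp_eq_id hF hG _ _ e.hom_inv_id
  inv_hom_id := P.extNat_comp_eq_id hG hF _ _ e.inv_hom_id

variable {K' : Type u} [Category.{v} K'] {L' : Type u₁} [Category.{v₁} L'] {J' : K' ⥤ L'}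

/-- The componentwise covering of a product category. -/
def prod (P : Presentation J) (Q : Presentation J') : Presentation (J.prod J') where
  obj X := (P.obj X.1, Q.obj X.2)
  π X := P.π X.1 ×ₘ Q.π X.2
  exists_lift f := by
    obtain ⟨φ, h⟩ := P.exists_lift f.1
    obtain ⟨ψ, h'⟩ := Q.exists_lift f.2
    exact ⟨φ ×ₘ ψ, Prod.hom_ext h h'⟩

lemma descends_prod (P : Presentation J) (Q : Presentation J') (F : L × L' ⥤ D)
    (h₁ : ∀ Y : L', P.Descends (Prod.sectL L Y ⋙ F))
    (h₂ : ∀ X : L, Q.Descends (Prod.sectR X L' ⋙ F)) : (P.prod Q).Descends F := by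
  have c {X X' X'' : L} {Y Y' Y'' : L'} (f : X ⟶ X') (f' : X' ⟶ X'') (g : Y ⟶ Y')
      (g' : Y' ⟶ Y'') : F.map (f ×ₘ g) ≫ F.map (f' ×ₘ g') = F.map ((f ≫ f') ×ₘ (g ≫ g')) :=
    (F.map_comp (f ×ₘ g) (f' ×ₘ g')).symm
  have ep₁ (X : L) (Y : L') : Epi (F.map (P.π X ×ₘ 𝟙 Y)) := (h₁ Y).epi X
  have ep₂ (X : L) (Y : L') : Epi (F.map (𝟙 X ×ₘ Q.π Y)) := (h₂ X).epi Y
  have e (X : L) (Y : L') : F.map (P.π X ×ₘ Q.π Y) =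
      F.map (P.π X ×ₘ 𝟙 _) ≫ F.map (𝟙 _ ×ₘ Q.π Y) := by
    rw [c, Category.comp_id, Category.id_comp]
  have main (X : L) (Y : L') {Z : D} (k : F.obj (J.obj (P.obj X), J'.obj (Q.obj Y)) ⟶ Z)
      (hk : ∀ {W : K} {W' : K'} (u w : W ⟶ P.obj X) (u' w' : W' ⟶ Q.obj Y),
        J.map u ≫ P.π X = J.map w ≫ P.π X → J'.map u' ≫ Q.π Y = J'.map w' ≫ Q.π Y →
        F.map (J.map u ×ₘ J'.map u') ≫ k = F.map (J.map w ×ₘ J'.map w') ≫ k) :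
      ∃ m : F.obj (X, Y) ⟶ Z, F.map (P.π X ×ₘ Q.π Y) ≫ m = k := by
    have s₁ : ∃ m : F.obj (X, J'.obj (Q.obj Y)) ⟶ Z, F.map (P.π X ×ₘ 𝟙 _) ≫ m = k := by
      refine (h₁ (J'.obj (Q.obj Y))).desc (X := X) k fun u w h => ?_
      have := hk u w (𝟙 _) (𝟙 _) h rfl
      rw [J'.map_id] at this
      exact this
    obtain ⟨m, hm⟩ := s₁
    have s₂ : ∃ m' : F.obj (X, Y) ⟶ Z, F.map (𝟙 X ×ₘ Q.π Y) ≫ m' = m := by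
      refine (h₂ X).desc (X := Y) m fun {W} u w h => ?_
      have t (u : W ⟶ Q.obj Y) : F.map (P.π X ×ₘ 𝟙 (J'.obj W)) ≫ F.map (𝟙 X ×ₘ J'.map u) ≫ m =
          F.map (𝟙 (J.obj (P.obj X)) ×ₘ J'.map u) ≫ k := by
        rw [← hm, ← Category.assoc, ← Category.assoc, c, c]
        simp only [Category.comp_id, Category.id_comp]
      have q := hk (𝟙 _) (𝟙 _) u w rfl h
      rw [J.map_id, ← t, ← t] at q
      exact (@cancel_epi _ _ _ _ _ _ (ep₁ X (J'.obj W)) _ _).1 q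
    obtain ⟨m', hm'⟩ := s₂
    exact ⟨m', by rw [e, Category.assoc, hm', hm]⟩
  refine ⟨fun X => ?_, fun {X Z} k hk => ?_⟩
  · have : F.map (P.π X.1 ×ₘ Q.π X.2) = _ := e X.1 X.2
    change Epi (F.map (P.π X.1 ×ₘ Q.π X.2))
    rw [this]
    exact epi_comp _ _
  · exact main X.1 X.2 k fun {W W'} u w u' w' h h' =>
      hk (W := (W, W')) (u ×ₘ u') (w ×ₘ w') (Prod.hom_ext h h')

end Presentation

end Presentation

variable (A) in
/-- The componentwise embedding in two variables. -/
abbrev emb₂ : A × A ⥤ Freyd A × Freyd A := emb.prod emb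

variable (A) in
/-- The componentwise embedding in three variables. -/
abbrev emb₃ : A × A × A ⥤ Freyd A × Freyd A × Freyd A := emb.prod (emb.prod emb)

variable (A) in
/-- `X` is covered by `emb X.gen`. -/
def pres₁ : Presentation (emb : A ⥤ Freyd A) where
  obj X := X.gen
  π X := proj X
  exists_lift f := exists_proj_comp f

variable (A) in
/-- `(X, Y)` is covered by `(emb X.gen, emb Y.gen)`. -/
def pres₂ : Presentation (emb₂ A) := (pres₁ A).prod (pres₁ A)

variable (A) in
/-- `(X, Y, Z)` is covered by `(emb X.gen, emb Y.gen, emb Z.gen)`. -/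
def pres₃ : Presentation (emb₃ A) := (pres₁ A).prod (pres₂ A)

section Descends

universe v₄ u₄

variable {E : Type u₄} [Category.{v₄} E] [Preadditive E]

lemma descends₁ (F : Freyd A ⥤ E) (h : IsRightExact F) : (pres₁ A).Descends F where
  epi X := (IsRightExact.desc F (emb_comp_proj X) (projIsColimit X)).1
  desc {X Z} k hk := by
    have := h.additive
    refine (IsRightExact.desc F (emb_comp_proj X) (projIsColimit X)).2 k ?_
    refine (hk (W := X.rel) X.ρ (0 : X.rel ⟶ X.gen) ?_).trans ?_
    · refine (emb_comp_proj X).trans ?_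
      exact ((congrArg (· ≫ proj X) (emb.map_zero X.rel X.gen)).trans zero_comp).symm
    · exact (congrArg (· ≫ k) ((congrArg F.map (emb.map_zero X.rel X.gen)).trans
        (F.map_zero _ _))).trans zero_comp

lemma descends₂ (F : Freyd A × Freyd A ⥤ E) (h : IsRightExact₂ F) : (pres₂ A).Descends F :=
  Presentation.descends_prod _ _ F (fun Y => descends₁ _ (h.left Y))
    (fun X => descends₁ _ (h.right X))

lemma descends₃ (F : Freyd A × Freyd A × Freyd A ⥤ E) (h : IsRightExact₃ F) :
    (pres₃ A).Descends F :=
  Presentation.descends_prod _ _ F (fun Y => descends₁ _ (h.fst Y.1 Y.2))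
    (fun X => descends₂ _ ⟨fun Z => h.snd X Z, fun Y => h.thd X Y⟩)

variable {F₁ G₁ : Freyd A ⥤ E} {F₂ G₂ : Freyd A × Freyd A ⥤ E}
  {F₃ G₃ : Freyd A × Freyd A × Freyd A ⥤ E}

/-- The extension of a natural transformation in one variable: for `X = (x ⟵ r_X)` the component
at `X` is induced on cokernels by the component at `x`. -/
def hat₁ [h : IsRightExact F₁] (α : emb ⋙ F₁ ⟶ emb ⋙ G₁) : F₁ ⟶ G₁ :=
  (pres₁ A).extNat (descends₁ F₁ h) α

/-- The extension of a natural transformation in two variables. -/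
def hat₂ [h : IsRightExact₂ F₂] (α : emb₂ A ⋙ F₂ ⟶ emb₂ A ⋙ G₂) : F₂ ⟶ G₂ :=
  (pres₂ A).extNat (descends₂ F₂ h) α

/-- The extension of a natural transformation in three variables. -/
def hat₃ [h : IsRightExact₃ F₃] (α : emb₃ A ⋙ F₃ ⟶ emb₃ A ⋙ G₃) : F₃ ⟶ G₃ :=
  (pres₃ A).extNat (descends₃ F₃ h) α

/-- The extension of a natural isomorphism in one variable. -/
def hatIso₁ [h : IsRightExact F₁] [h' : IsRightExact G₁] (e : emb ⋙ F₁ ≅ emb ⋙ G₁) : F₁ ≅ G₁ :=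
  (pres₁ A).extIso (descends₁ F₁ h) (descends₁ G₁ h') e

/-- The extension of a natural isomorphism in two variables. -/
def hatIso₂ [h : IsRightExact₂ F₂] [h' : IsRightExact₂ G₂] (e : emb₂ A ⋙ F₂ ≅ emb₂ A ⋙ G₂) :
    F₂ ≅ G₂ :=
  (pres₂ A).extIso (descends₂ F₂ h) (descends₂ G₂ h') e

/-- The extension of a natural isomorphism in three variables. -/
def hatIso₃ [h : IsRightExact₃ F₃] [h' : IsRightExact₃ G₃] (e : emb₃ A ⋙ F₃ ≅ emb₃ A ⋙ G₃) :
    F₃ ≅ G₃ :=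
  (pres₃ A).extIso (descends₃ F₃ h) (descends₃ G₃ h') e

end Descends

end Freyd

section Tensor

open CategoryTheory.Prod

variable {C : Type u} [Category.{v} C] (H : C × C ⥤ C)

/-- The functor `(X, Y, Z) ↦ X ⊗ (Y ⊗ Z)`, where `X ⊗ Y` denotes `H (X, Y)`. -/
abbrev tensorR : C × C × C ⥤ C := (𝟭 C).prod H ⋙ H

/-- The functor `(X, Y, Z) ↦ (X ⊗ Y) ⊗ Z`. -/
abbrev tensorL : C × C × C ⥤ C := prod.inverseAssociator C C C ⋙ H.prod (𝟭 C) ⋙ H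

/-- The functor `(X, Y) ↦ Y ⊗ X`. -/
abbrev tensorOp : C × C ⥤ C := CategoryTheory.Prod.swap C C ⋙ H

/-- The functor `X ↦ I ⊗ X`. -/
abbrev tensorUnitL (I : C) : C ⥤ C := Prod.sectR I C ⋙ H

/-- The functor `X ↦ X ⊗ I`. -/
abbrev tensorUnitR (I : C) : C ⥤ C := Prod.sectL C I ⋙ H

section RightExact

variable [Preadditive C] [h : IsRightExact₂ H]

instance isRightExact_id : IsRightExact (𝟭 C) where
  additive := inferInstance
  preserves _ := inferInstance

instance isRightExact_tensorUnitL (I : C) : IsRightExact (tensorUnitL H I) := h.right I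

instance isRightExact_tensorUnitR (I : C) : IsRightExact (tensorUnitR H I) := h.left I

instance isRightExact_tensorOp : IsRightExact₂ (tensorOp H) where
  left Y := IsRightExact.of_iso (F := Prod.sectR Y C ⋙ H) (h := h.right Y)
    (NatIso.ofComponents (fun _ => Iso.refl _)
        (fun _ => (Category.comp_id _).trans (Eq.trans rfl (Category.id_comp _).symm)))
  right X := IsRightExact.of_iso (F := Prod.sectL C X ⋙ H) (h := h.left X)
    (NatIso.ofComponents (fun _ => Iso.refl _)
        (fun _ => (Category.comp_id _).trans (Eq.trans rfl (Category.id_comp _).symm)))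

instance isRightExact_tensorR : IsRightExact₃ (tensorR H) where
  fst Y Z := IsRightExact.of_iso (F := Prod.sectL C (H.obj (Y, Z)) ⋙ H) (h := h.left _)
    (NatIso.ofComponents (fun _ => Iso.refl _)
      (fun f => (Category.comp_id _).trans (Eq.trans (congrArg (fun t => H.map (f ×ₘ t)) (H.map_id (Y, Z)).symm) (Category.id_comp _).symm)))
  snd X Z :=
    have := h.left Z
    have := h.right X
    IsRightExact.of_iso (F := (Prod.sectL C Z ⋙ H) ⋙ Prod.sectR X C ⋙ H) (h := IsRightExact.comp _ _)
      (NatIso.ofComponents (fun _ => Iso.refl _)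
        (fun _ => (Category.comp_id _).trans (Eq.trans rfl (Category.id_comp _).symm)))
  thd X Y :=
    have := h.right Y
    have := h.right X
    IsRightExact.of_iso (F := (Prod.sectR Y C ⋙ H) ⋙ Prod.sectR X C ⋙ H) (h := IsRightExact.comp _ _)
      (NatIso.ofComponents (fun _ => Iso.refl _)
        (fun _ => (Category.comp_id _).trans (Eq.trans rfl (Category.id_comp _).symm)))

instance isRightExact_tensorL : IsRightExact₃ (tensorL H) where
  fst Y Z :=
    have := h.left Y
    have := h.left Z
    IsRightExact.of_iso (F := (Prod.sectL C Y ⋙ H) ⋙ Prod.sectL C Z ⋙ H) (h := IsRightExact.comp _ _)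
      (NatIso.ofComponents (fun _ => Iso.refl _)
        (fun _ => (Category.comp_id _).trans (Eq.trans rfl (Category.id_comp _).symm)))
  snd X Z :=
    have := h.right X
    have := h.left Z
    IsRightExact.of_iso (F := (Prod.sectR X C ⋙ H) ⋙ Prod.sectL C Z ⋙ H) (h := IsRightExact.comp _ _)
      (NatIso.ofComponents (fun _ => Iso.refl _)
        (fun _ => (Category.comp_id _).trans (Eq.trans rfl (Category.id_comp _).symm)))
  thd X Y := IsRightExact.of_iso (F := Prod.sectR (H.obj (X, Y)) C ⋙ H) (h := h.right _)
    (NatIso.ofComponents (fun _ => Iso.refl _)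
      (fun f => (Category.comp_id _).trans (Eq.trans (congrArg (fun t => H.map (t ×ₘ f)) (H.map_id (X, Y)).symm) (Category.id_comp _).symm)))

end RightExact

section Identities

variable {H}

/-- The component `X ⊗ (Y ⊗ Z) ⟶ (X ⊗ Y) ⊗ Z` of an associator. -/
abbrev assocAt (α : tensorR H ⟶ tensorL H) (X Y Z : C) :
    H.obj (X, H.obj (Y, Z)) ⟶ H.obj (H.obj (X, Y), Z) := α.app (X, Y, Z)

/-- The component `X ⊗ Y ⟶ Y ⊗ X` of a braiding. -/
abbrev braidAt (β : H ⟶ tensorOp H) (X Y : C) : H.obj (X, Y) ⟶ H.obj (Y, X) := β.app (X, Y)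

/-- The component `I ⊗ X ⟶ X` of a left unitor. -/
abbrev leftAt {I : C} (l : tensorUnitL H I ⟶ 𝟭 C) (X : C) : H.obj (I, X) ⟶ X := l.app X

/-- The component `X ⊗ I ⟶ X` of a right unitor. -/
abbrev rightAt {I : C} (r : tensorUnitR H I ⟶ 𝟭 C) (X : C) : H.obj (X, I) ⟶ X := r.app X

/-- The pentagon identity at `X, Y, Z, W`. -/
def PentagonAt (α : tensorR H ⟶ tensorL H) (X Y Z W : C) : Prop :=
  H.map (𝟙 X ×ₘ assocAt α Y Z W) ≫ assocAt α X (H.obj (Y, Z)) W ≫ H.map (assocAt α X Y Z ×ₘ 𝟙 W) =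
    assocAt α X Y (H.obj (Z, W)) ≫ assocAt α (H.obj (X, Y)) Z W

/-- The triangle identity at `X, Y`. -/
def TriangleAt {I : C} (α : tensorR H ⟶ tensorL H) (l : tensorUnitL H I ⟶ 𝟭 C)
    (r : tensorUnitR H I ⟶ 𝟭 C) (X Y : C) : Prop :=
  assocAt α X I Y ≫ H.map (rightAt r X ×ₘ 𝟙 Y) = H.map (𝟙 X ×ₘ leftAt l Y)

/-- Compatibility of a braiding with the unitors at `X`. -/
def BraidingUnitAt {I : C} (l : tensorUnitL H I ⟶ 𝟭 C) (r : tensorUnitR H I ⟶ 𝟭 C)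
    (β : H ⟶ tensorOp H) (X : C) : Prop :=
  braidAt β X I ≫ leftAt l X = rightAt r X

/-- The hexagon identity for `(X ⊗ Y) ⊗ Z ⟶ (Z ⊗ X) ⊗ Y`. -/
def HexagonOneAt (α : tensorR H ≅ tensorL H) (β : H ⟶ tensorOp H) (X Y Z : C) : Prop :=
  braidAt β (H.obj (X, Y)) Z ≫ assocAt α.hom Z X Y =
    (α.app (X, Y, Z)).inv ≫ H.map (𝟙 X ×ₘ braidAt β Y Z) ≫ assocAt α.hom X Z Y ≫
      H.map (braidAt β X Z ×ₘ 𝟙 Y)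

/-- The hexagon identity for `X ⊗ (Y ⊗ Z) ⟶ Y ⊗ (Z ⊗ X)`. -/
def HexagonTwoAt (α : tensorR H ≅ tensorL H) (β : H ⟶ tensorOp H) (X Y Z : C) : Prop :=
  braidAt β X (H.obj (Y, Z)) ≫ (α.app (Y, Z, X)).inv =
    assocAt α.hom X Y Z ≫ H.map (braidAt β X Y ×ₘ 𝟙 Z) ≫ (α.app (Y, X, Z)).inv ≫
      H.map (𝟙 Y ×ₘ braidAt β X Z)

/-- The variant of the first hexagon identity in which the edge `X ⊗ Z ⟶ Z ⊗ X` is traversed by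
`Z ⊗ X ⟶ X ⊗ Z` in the opposite direction. -/
def HexagonOneAt' (α : tensorR H ≅ tensorL H) (β : H ⟶ tensorOp H) (X Y Z : C) : Prop :=
  braidAt β (H.obj (X, Y)) Z ≫ assocAt α.hom Z X Y ≫ H.map (braidAt β Z X ×ₘ 𝟙 Y) =
    (α.app (X, Y, Z)).inv ≫ H.map (𝟙 X ×ₘ braidAt β Y Z) ≫ assocAt α.hom X Z Y

/-- The variant of the second hexagon identity in which the edge `X ⊗ Z ⟶ Z ⊗ X` is traversed by
`Z ⊗ X ⟶ X ⊗ Z` in the opposite direction. -/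
def HexagonTwoAt' (α : tensorR H ≅ tensorL H) (β : H ⟶ tensorOp H) (X Y Z : C) : Prop :=
  braidAt β X (H.obj (Y, Z)) ≫ (α.app (Y, Z, X)).inv ≫ H.map (𝟙 Y ×ₘ braidAt β Z X) =
    assocAt α.hom X Y Z ≫ H.map (braidAt β X Y ×ₘ 𝟙 Z) ≫ (α.app (Y, X, Z)).inv

/-- The symmetry identity at `X, Y`. -/
def SymmetryAt (β : H ⟶ tensorOp H) (X Y : C) : Prop :=
  braidAt β X Y ≫ braidAt β Y X = 𝟙 (H.obj (X, Y))

/-- The monoidal data (without any coherence) given by a functor `H : C × C ⥤ C`, an object `I`,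
and natural isomorphisms. -/
abbrev monoidalStruct {I : C} (α : tensorR H ≅ tensorL H) (l : tensorUnitL H I ≅ 𝟭 C)
    (r : tensorUnitR H I ≅ 𝟭 C) : MonoidalCategoryStruct C where
  tensorObj X Y := H.obj (X, Y)
  whiskerLeft X _ _ f := H.map (𝟙 X ×ₘ f)
  whiskerRight f Y := H.map (f ×ₘ 𝟙 Y)
  tensorHom f g := H.map (f ×ₘ g)
  tensorUnit := I
  associator X Y Z := (α.app (X, Y, Z)).symm
  leftUnitor X := l.app X
  rightUnitor X := r.app X

end Identities

end Tensor

open Freyd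

/-- A finitely presented promonoidal structure on `A`. Tensor products of objects of `A` are formed
in `Freyd A`, via the embedding `emb`, with the extension `extend₂ tensor` of the protensor
product. -/
structure FPPromonoidal (A : Type u) [Category.{v} A] [Preadditive A] [HasZeroObject A]
    [HasBinaryBiproducts A] where
  tensor : A × A ⥤ Freyd A
  [bilinear : IsBilinear tensor]
  assoc : emb₃ A ⋙ tensorR (extend₂ tensor) ≅ emb₃ A ⋙ tensorL (extend₂ tensor)
  pentagon : ∀ a b c d : A,
    PentagonAt (hatIso₃ assoc).hom (emb.obj a) (emb.obj b) (emb.obj c) (emb.obj d)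
  unit : Freyd A
  leftUnitor : emb ⋙ tensorUnitL (extend₂ tensor) unit ≅ emb ⋙ 𝟭 (Freyd A)
  rightUnitor : emb ⋙ tensorUnitR (extend₂ tensor) unit ≅ emb ⋙ 𝟭 (Freyd A)
  triangle : ∀ a b : A, TriangleAt (hatIso₃ assoc).hom (hatIso₁ leftUnitor).hom
    (hatIso₁ rightUnitor).hom (emb.obj a) (emb.obj b)

namespace FPPromonoidal

variable {A : Type u} [Category.{v} A] [Preadditive A] [HasZeroObject A] [HasBinaryBiproducts A]

attribute [instance] bilinear

/-- The extended monoidal data on the Freyd category. -/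
abbrev extStruct (P : FPPromonoidal A) : MonoidalCategoryStruct (Freyd A) :=
  monoidalStruct (hatIso₃ P.assoc) (hatIso₁ P.leftUnitor) (hatIso₁ P.rightUnitor)

/-- A finitely presented probraiding on a finitely presented promonoidal structure. -/
structure Braiding (P : FPPromonoidal A) where
  braid : emb₂ A ⋙ extend₂ P.tensor ≅ emb₂ A ⋙ tensorOp (extend₂ P.tensor)
  unit : ∀ a : A, BraidingUnitAt (hatIso₁ P.leftUnitor).hom (hatIso₁ P.rightUnitor).hom
    (hatIso₂ braid).hom (emb.obj a)
  hexagonOne : ∀ a b c : A, HexagonOneAt (hatIso₃ P.assoc) (hatIso₂ braid).hom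
    (emb.obj a) (emb.obj b) (emb.obj c)
  hexagonTwo : ∀ a b c : A, HexagonTwoAt (hatIso₃ P.assoc) (hatIso₂ braid).hom
    (emb.obj a) (emb.obj b) (emb.obj c)

/-- The probraiding is symmetric: `a ⊗ b ⟶ b ⊗ a ⟶ a ⊗ b` is the identity for `a, b` in `A`. -/
def Braiding.IsSymmetric {P : FPPromonoidal A} (β : P.Braiding) : Prop :=
  ∀ a b : A, β.braid.hom.app (a, b) ≫ β.braid.hom.app (b, a) = 𝟙 _

end FPPromonoidal

end

open Freyd

/-!
The extension `extend₂ T` preserves cokernels in each variable, and every object `X` of the Freyd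
category is the cokernel of `emb X.rel ⟶ emb X.gen`, with projection `proj X`. Two facts follow for
any functor `F` of several variables that is right exact in each of them.

* `F` sends every tuple of projections `proj X` to an epimorphism, and a morphism out of its source
  that respects the relations factors uniquely through it. Hence natural transformations on objects
  of `A` extend uniquely (`Presentation.whiskerLeft_extNat`, `Presentation.eq_extNat`). The inverse
  of an isomorphism extends as well, and extensions compose, so that invertibility can be tested on
  `A` (`Presentation.isIso_extNat_app_iff`).
* Both sides of each coherence identity are natural in all the objects involved. Along a tuple of
  projections, the identity at `X, Y, …` is therefore a consequence of the identity at
  `emb X.gen, emb Y.gen, …`, since the map between the sources is an epimorphism. The lemmas named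
  `of_epi` make this inference for an arbitrary functor `H : C × C ⥤ C`; the required epimorphisms
  are the instances `epi_map_proj`, `epi_map_proj_tensorR`, `epi_map_proj_pentagon` and so on.

On `A` itself the relations defining `extend₂ T` vanish (`isIso_genπ_emb`), so that `extend₂ T`
restricts to `T`. Once the coherence identities hold at all objects, they are, up to inverting the
associator, the axioms of a (braided, symmetric) monoidal category.
-/

open CategoryTheory.Prod

/-! ### Coherence identities along natural families of morphisms -/

section Naturality

variable {C : Type u} [Category.{v} C] {H : C × C ⥤ C}

lemma map_commSq_tensor {X Y Z W X' Y' Z' W' : C} {f : W ⟶ X} {g : W ⟶ Y} {h : X ⟶ Z} {i : Y ⟶ Z}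
    {f' : W' ⟶ X'} {g' : W' ⟶ Y'} {h' : X' ⟶ Z'} {i' : Y' ⟶ Z'}
    (s : CommSq f g h i) (s' : CommSq f' g' h' i') :
    CommSq (H.map (f ×ₘ f')) (H.map (g ×ₘ g')) (H.map (h ×ₘ h')) (H.map (i ×ₘ i')) :=
  CommSq.map H ⟨Prod.hom_ext s.w s'.w⟩

lemma commSq_id {X Y : C} (f : X ⟶ Y) : CommSq (𝟙 X) f f (𝟙 Y) :=
  ⟨(Category.id_comp f).trans (Category.comp_id f).symm⟩

lemma commSq_natTrans {D : Type u₁} [Category.{v₁} D] {F G : D ⥤ C} (α : F ⟶ G) {X Y : D}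
    (f : X ⟶ Y) : CommSq (α.app X) (F.map f) (G.map f) (α.app Y) :=
  ⟨(α.naturality f).symm⟩

/-- Equality of parallel morphisms passes along an epimorphism of sources `p` and a morphism of
targets `q` with which both morphisms are compatible. -/
lemma eq_of_commSq_of_epi {X Y X' Y' : C} {a b : X ⟶ Y} {a' b' : X' ⟶ Y'} {p : X ⟶ X'} {q : Y ⟶ Y'}
    [Epi p] (ha : CommSq a p q a') (hb : CommSq b p q b') (h : a = b) : a' = b' := by
  rw [← cancel_epi p, ← ha.w, ← hb.w, h]

lemma commSq_assocAt (α : tensorR H ⟶ tensorL H) {X X' Y Y' Z Z' : C} (f : X ⟶ X') (g : Y ⟶ Y')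
    (h : Z ⟶ Z') : CommSq (assocAt α X Y Z) (H.map (f ×ₘ H.map (g ×ₘ h)))
      (H.map (H.map (f ×ₘ g) ×ₘ h)) (assocAt α X' Y' Z') :=
  commSq_natTrans α (X := (X, Y, Z)) (Y := (X', Y', Z')) (f ×ₘ (g ×ₘ h))

lemma commSq_assocAt_inv (α : tensorR H ≅ tensorL H) {X X' Y Y' Z Z' : C} (f : X ⟶ X')
    (g : Y ⟶ Y') (h : Z ⟶ Z') : CommSq (α.app (X, Y, Z)).inv (H.map (H.map (f ×ₘ g) ×ₘ h))
      (H.map (f ×ₘ H.map (g ×ₘ h))) (α.app (X', Y', Z')).inv :=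
  commSq_natTrans α.inv (X := (X, Y, Z)) (Y := (X', Y', Z')) (f ×ₘ (g ×ₘ h))

lemma commSq_braidAt (β : H ⟶ tensorOp H) {X X' Y Y' : C} (f : X ⟶ X') (g : Y ⟶ Y') :
    CommSq (braidAt β X Y) (H.map (f ×ₘ g)) (H.map (g ×ₘ f)) (braidAt β X' Y') :=
  commSq_natTrans β (X := (X, Y)) (Y := (X', Y')) (f ×ₘ g)

lemma commSq_leftAt {I : C} (l : tensorUnitL H I ⟶ 𝟭 C) {X X' : C} (f : X ⟶ X') :
    CommSq (leftAt l X) (H.map (𝟙 I ×ₘ f)) f (leftAt l X') :=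
  commSq_natTrans l f

lemma commSq_rightAt {I : C} (r : tensorUnitR H I ⟶ 𝟭 C) {X X' : C} (f : X ⟶ X') :
    CommSq (rightAt r X) (H.map (f ×ₘ 𝟙 I)) f (rightAt r X') :=
  commSq_natTrans r f

lemma PentagonAt.of_epi {α : tensorR H ⟶ tensorL H} {X X' Y Y' Z Z' W W' : C} (f : X ⟶ X')
    (g : Y ⟶ Y') (h : Z ⟶ Z') (k : W ⟶ W') [Epi (H.map (f ×ₘ H.map (g ×ₘ H.map (h ×ₘ k))))]
    (p : PentagonAt α X Y Z W) : PentagonAt α X' Y' Z' W' :=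
  eq_of_commSq_of_epi
    ((map_commSq_tensor (commSq_id f) (commSq_assocAt α g h k)).horiz_comp
      ((commSq_assocAt α f (H.map (g ×ₘ h)) k).horiz_comp
        (map_commSq_tensor (commSq_assocAt α f g h) (commSq_id k))))
    ((commSq_assocAt α f g (H.map (h ×ₘ k))).horiz_comp
      (commSq_assocAt α (H.map (f ×ₘ g)) h k)) p

lemma TriangleAt.of_epi {I : C} {α : tensorR H ⟶ tensorL H} {l : tensorUnitL H I ⟶ 𝟭 C}
    {r : tensorUnitR H I ⟶ 𝟭 C} {X X' Y Y' : C} (f : X ⟶ X') (g : Y ⟶ Y')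
    [Epi (H.map (f ×ₘ H.map (𝟙 I ×ₘ g)))] (p : TriangleAt α l r X Y) : TriangleAt α l r X' Y' :=
  eq_of_commSq_of_epi
    ((commSq_assocAt α f (𝟙 I) g).horiz_comp (map_commSq_tensor (commSq_rightAt r f) (commSq_id g)))
    (map_commSq_tensor (commSq_id f) (commSq_leftAt l g)) p

lemma BraidingUnitAt.of_epi {I : C} {l : tensorUnitL H I ⟶ 𝟭 C} {r : tensorUnitR H I ⟶ 𝟭 C}
    {β : H ⟶ tensorOp H} {X X' : C} (f : X ⟶ X') [Epi (H.map (f ×ₘ 𝟙 I))]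
    (p : BraidingUnitAt l r β X) : BraidingUnitAt l r β X' :=
  eq_of_commSq_of_epi ((commSq_braidAt β f (𝟙 I)).horiz_comp (commSq_leftAt l f))
    (commSq_rightAt r f) p

lemma SymmetryAt.of_epi {β : H ⟶ tensorOp H} {X X' Y Y' : C} (f : X ⟶ X') (g : Y ⟶ Y')
    [Epi (H.map (f ×ₘ g))] (p : SymmetryAt β X Y) : SymmetryAt β X' Y' :=
  eq_of_commSq_of_epi ((commSq_braidAt β f g).horiz_comp (commSq_braidAt β g f))
    (commSq_id (H.map (f ×ₘ g))) p

section Hexagon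

variable {α : tensorR H ≅ tensorL H} {β : H ⟶ tensorOp H} {X X' Y Y' Z Z' : C} (f : X ⟶ X')
  (g : Y ⟶ Y') (h : Z ⟶ Z')

lemma HexagonOneAt.of_epi [Epi (H.map (H.map (f ×ₘ g) ×ₘ h))]
    (p : HexagonOneAt α β X Y Z) : HexagonOneAt α β X' Y' Z' :=
  eq_of_commSq_of_epi
    ((commSq_braidAt β (H.map (f ×ₘ g)) h).horiz_comp (commSq_assocAt α.hom h f g))
    ((commSq_assocAt_inv α f g h).horiz_comp
      ((map_commSq_tensor (commSq_id f) (commSq_braidAt β g h)).horiz_comp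
        ((commSq_assocAt α.hom f h g).horiz_comp
          (map_commSq_tensor (commSq_braidAt β f h) (commSq_id g))))) p

lemma HexagonOneAt'.of_epi [Epi (H.map (H.map (f ×ₘ g) ×ₘ h))]
    (p : HexagonOneAt' α β X Y Z) : HexagonOneAt' α β X' Y' Z' :=
  eq_of_commSq_of_epi
    ((commSq_braidAt β (H.map (f ×ₘ g)) h).horiz_comp ((commSq_assocAt α.hom h f g).horiz_comp
      (map_commSq_tensor (commSq_braidAt β h f) (commSq_id g))))
    ((commSq_assocAt_inv α f g h).horiz_comp
      ((map_commSq_tensor (commSq_id f) (commSq_braidAt β g h)).horiz_comp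
        (commSq_assocAt α.hom f h g))) p

lemma HexagonTwoAt.of_epi [Epi (H.map (f ×ₘ H.map (g ×ₘ h)))]
    (p : HexagonTwoAt α β X Y Z) : HexagonTwoAt α β X' Y' Z' :=
  eq_of_commSq_of_epi
    ((commSq_braidAt β f (H.map (g ×ₘ h))).horiz_comp (commSq_assocAt_inv α g h f))
    ((commSq_assocAt α.hom f g h).horiz_comp
      ((map_commSq_tensor (commSq_braidAt β f g) (commSq_id h)).horiz_comp
        ((commSq_assocAt_inv α g f h).horiz_comp
          (map_commSq_tensor (commSq_id g) (commSq_braidAt β f h))))) p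

lemma HexagonTwoAt'.of_epi [Epi (H.map (f ×ₘ H.map (g ×ₘ h)))]
    (p : HexagonTwoAt' α β X Y Z) : HexagonTwoAt' α β X' Y' Z' :=
  eq_of_commSq_of_epi
    ((commSq_braidAt β f (H.map (g ×ₘ h))).horiz_comp ((commSq_assocAt_inv α g h f).horiz_comp
      (map_commSq_tensor (commSq_id g) (commSq_braidAt β h f))))
    ((commSq_assocAt α.hom f g h).horiz_comp
      ((map_commSq_tensor (commSq_braidAt β f g) (commSq_id h)).horiz_comp
        (commSq_assocAt_inv α g f h))) p

end Hexagon

end Naturality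

/-! ### Monoidal categories from coherent natural isomorphisms -/

section Coherence

variable {C : Type u} [Category.{v} C] {H : C × C ⥤ C} {I : C}

/-- The monoidal category given by natural isomorphisms that satisfy the pentagon and the triangle
identities. The associator of Mathlib points from `(X ⊗ Y) ⊗ Z` to `X ⊗ (Y ⊗ Z)`, so both identities
are inverted here. -/
abbrev monoidalOfCoherent (α : tensorR H ≅ tensorL H) (l : tensorUnitL H I ≅ 𝟭 C)
    (r : tensorUnitR H I ≅ 𝟭 C) (hp : ∀ X Y Z W : C, PentagonAt α.hom X Y Z W)
    (ht : ∀ X Y : C, TriangleAt α.hom l.hom r.hom X Y) : MonoidalCategory C where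
  toMonoidalCategoryStruct := monoidalStruct α l r
  tensorHom_def f g := (congrArg H.map (Prod.hom_ext (Category.comp_id f).symm
    (Category.id_comp g).symm)).trans (H.map_comp _ _)
  id_tensorHom_id X Y := H.map_id (X, Y)
  tensorHom_comp_tensorHom f₁ f₂ g₁ g₂ := (H.map_comp (f₁ ×ₘ f₂) (g₁ ×ₘ g₂)).symm
  whiskerLeft_id X Y := H.map_id (X, Y)
  id_whiskerRight X Y := H.map_id (X, Y)
  associator_naturality f g h := (commSq_assocAt_inv α f g h).w.symm
  leftUnitor_naturality f := l.hom.naturality f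
  rightUnitor_naturality f := r.hom.naturality f
  pentagon X Y Z W := (Category.assoc _ _ _).symm.trans (congrArg Iso.inv (Iso.ext (hp X Y Z W) :
    H.mapIso (Iso.prod (Iso.refl X) (α.app (Y, Z, W))) ≪≫ α.app (X, H.obj (Y, Z), W) ≪≫
      H.mapIso (Iso.prod (α.app (X, Y, Z)) (Iso.refl W)) =
    α.app (X, Y, H.obj (Z, W)) ≪≫ α.app (H.obj (X, Y), Z, W)))
  triangle X Y := (Iso.inv_comp_eq (α.app (X, I, Y))).2 (ht X Y).symm

/-- The braided monoidal category given by a braiding that satisfies the hexagon identities;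
compatibility with the unitors is a consequence of the hexagon identities. -/
abbrev braidedOfCoherent (α : tensorR H ≅ tensorL H) (l : tensorUnitL H I ≅ 𝟭 C)
    (r : tensorUnitR H I ≅ 𝟭 C) (hp : ∀ X Y Z W : C, PentagonAt α.hom X Y Z W)
    (ht : ∀ X Y : C, TriangleAt α.hom l.hom r.hom X Y) (β : H ≅ tensorOp H)
    (h₁ : ∀ X Y Z : C, HexagonOneAt α β.hom X Y Z) (h₂ : ∀ X Y Z : C, HexagonTwoAt α β.hom X Y Z) :
    @BraidedCategory C _ (monoidalOfCoherent α l r hp ht) :=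
  @BraidedCategory.mk C _ (monoidalOfCoherent α l r hp ht) (fun X Y => β.app (X, Y))
    (fun X _ _ f => (commSq_braidAt β.hom (𝟙 X) f).w.symm)
    (fun f Z => (commSq_braidAt β.hom f (𝟙 Z)).w.symm)
    (fun X Y Z => (Iso.inv_comp_eq (α.app (X, Y, Z))).2 (h₂ X Y Z))
    (fun X Y Z => by
      have h : braidAt β.hom (H.obj (X, Y)) Z ≫ assocAt α.hom Z X Y = _ := h₁ X Y Z
      exact (Iso.eq_inv_comp (α.app (X, Y, Z))).1 h)

end Coherence

namespace Freyd

/-! ### Extensions of natural transformations along a presentation -/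

namespace Presentation

universe v₄ u₄

variable {K : Type u₂} [Category.{v₂} K] {L : Type u₃} [Category.{v₃} L]
  {D : Type u₄} [Category.{v₄} D] {J : K ⥤ L} (P : Presentation J) {F G : L ⥤ D}

/-- The extension restricts to the given transformation as soon as the covering of each object in
the image of `J` comes from `K`. -/
lemma whiskerLeft_extNat (hP : ∀ a : K, ∃ φ : P.obj (J.obj a) ⟶ a, J.map φ = P.π (J.obj a))
    (hF : P.Descends F) (α : J ⋙ F ⟶ J ⋙ G) : Functor.whiskerLeft J (P.extNat hF α) = α := by
  ext a
  obtain ⟨φ, hφ⟩ := hP a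
  have := hF.epi (J.obj a)
  have hn := α.naturality φ
  dsimp at hn ⊢
  rw [← cancel_epi (F.map (P.π (J.obj a))), P.π_extNat hF α, ← hφ, hn]

lemma eq_extNat (hF : P.Descends F) (α : J ⋙ F ⟶ J ⋙ G) (γ : F ⟶ G)
    (h : Functor.whiskerLeft J γ = α) : γ = P.extNat hF α := by
  subst h
  ext X
  have := hF.epi X
  rw [← cancel_epi (F.map (P.π X)), P.π_extNat hF, γ.naturality]
  rfl

lemma isIso_extNat_app_iff
    (hP : ∀ a : K, ∃ φ : P.obj (J.obj a) ⟶ a, J.map φ = P.π (J.obj a))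
    (hF : P.Descends F) (hG : P.Descends G) (α : J ⋙ F ⟶ J ⋙ G) :
    (∀ X, IsIso ((P.extNat hF α).app X)) ↔ ∀ a, IsIso (α.app a) := by
  refine ⟨fun h a => ?_, fun h X => ?_⟩
  · rw [← P.whiskerLeft_extNat hP hF α]
    exact h (J.obj a)
  · have : IsIso α := NatIso.isIso_of_isIso_app α
    exact inferInstanceAs (IsIso ((P.extIso hF hG (asIso α)).hom.app X))

end Presentation

variable {A : Type u} [Category.{v} A] [Preadditive A] [HasZeroObject A] [HasBinaryBiproducts A]

/-! ### Restriction along the embedding of `A` into its Freyd category -/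

section Restriction

variable (A) in
lemma exists_map_eq_pres₁ (a : A) :
    ∃ φ : (pres₁ A).obj (emb.obj a) ⟶ a, emb.map φ = (pres₁ A).π (emb.obj a) :=
  ⟨𝟙 a, rfl⟩

variable (A) in
lemma exists_map_eq_pres₂ (a : A × A) :
    ∃ φ : (pres₂ A).obj ((emb₂ A).obj a) ⟶ a, (emb₂ A).map φ = (pres₂ A).π ((emb₂ A).obj a) :=
  ⟨𝟙 a, rfl⟩

variable (A) in
lemma exists_map_eq_pres₃ (a : A × A × A) :
    ∃ φ : (pres₃ A).obj ((emb₃ A).obj a) ⟶ a, (emb₃ A).map φ = (pres₃ A).π ((emb₃ A).obj a) :=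
  ⟨𝟙 a, rfl⟩

/-- For objects of `A` the relations of `extend₂` start in `F (0, b) ⊞ F (a, 0)`, which vanish by
bilinearity, so that the projection from `F (a, b)` is invertible. -/
instance isIso_genπ_emb {B : Type u₁} [Category.{v₁} B] [Preadditive B] [HasBinaryBiproducts B]
    [HasCokernels B] (F : A × A ⥤ B) [IsBilinear F] (a b : A) :
    IsIso (genπ F (emb.obj a) (emb.obj b)) := by
  have h₁ := IsBilinear.left (F := F) b
  have h₂ := IsBilinear.right (F := F) a
  obtain ⟨m, hm⟩ := genπ_desc F (X := emb.obj a) (Y := emb.obj b) (𝟙 (F.obj (a, b)))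
    ((congrArg (· ≫ 𝟙 _) ((Prod.sectL A b ⋙ F).map_zero _ _)).trans zero_comp)
    ((congrArg (· ≫ 𝟙 _) ((Prod.sectR a A ⋙ F).map_zero _ _)).trans zero_comp)
  have : IsSplitMono (genπ F (emb.obj a) (emb.obj b)) := IsSplitMono.mk' ⟨m, hm⟩
  exact isIso_of_epi_of_isSplitMono _

/-- The extension of a bilinear functor restricts to the functor itself. -/
noncomputable def restrictExtend₂Iso {B : Type u₁} [Category.{v₁} B] [Preadditive B]
    [HasBinaryBiproducts B] [HasCokernels B] (F : A × A ⥤ B) [IsBilinear F] :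
    emb₂ A ⋙ extend₂ F ≅ F :=
  (NatIso.ofComponents (fun a => @asIso _ _ _ _ _ (isIso_genπ_emb F a.1 a.2)) (by
    rintro ⟨a, b⟩ ⟨a', b'⟩ ⟨f, g⟩
    exact (genπ_map F (X := emb.obj a) (X' := emb.obj a') (Y := emb.obj b) (Y' := emb.obj b')
      f g _ _).symm)).symm

variable {E : Type u₁} [Category.{v₁} E] [Preadditive E]

lemma whiskerLeft_hat₂ {F G : Freyd A × Freyd A ⥤ E} [h : IsRightExact₂ F]
    (β : emb₂ A ⋙ F ⟶ emb₂ A ⋙ G) : Functor.whiskerLeft (emb₂ A) (hat₂ β) = β :=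
  (pres₂ A).whiskerLeft_extNat (exists_map_eq_pres₂ A) (descends₂ F h) β

lemma symmetryAt_hat₂_emb_iff {H : Freyd A × Freyd A ⥤ Freyd A} [IsRightExact₂ H]
    (β : emb₂ A ⋙ H ⟶ emb₂ A ⋙ tensorOp H) (a b : A) :
    SymmetryAt (hat₂ β) (emb.obj a) (emb.obj b) ↔ β.app (a, b) ≫ β.app (b, a) = 𝟙 _ := by
  have e (a b : A) : (hat₂ β).app (emb.obj a, emb.obj b) = β.app (a, b) :=
    congr_app (whiskerLeft_hat₂ β) (a, b)
  exact iff_of_eq (congrArg₂ (fun x y => x ≫ y = 𝟙 (H.obj (emb.obj a, emb.obj b))) (e a b) (e b a))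

end Restriction

/-! ### Tensor products of the canonical projections are epimorphisms -/

section Covering

variable (H : Freyd A × Freyd A ⥤ Freyd A) [h : IsRightExact₂ H]

instance epi_map_proj_unit (I X : Freyd A) : Epi (H.map (proj X ×ₘ 𝟙 I)) :=
  (descends₁ (tensorUnitR H I) inferInstance).epi X

instance epi_map_proj (X Y : Freyd A) : Epi (H.map (proj X ×ₘ proj Y)) :=
  (descends₂ H h).epi (X, Y)

instance epi_map_proj_tensorR (X Y Z : Freyd A) :
    Epi (H.map (proj X ×ₘ H.map (proj Y ×ₘ proj Z))) :=
  (descends₃ (tensorR H) inferInstance).epi (X, Y, Z)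

instance epi_map_proj_tensorL (X Y Z : Freyd A) :
    Epi (H.map (H.map (proj X ×ₘ proj Y) ×ₘ proj Z)) :=
  (descends₃ (tensorL H) inferInstance).epi (X, Y, Z)

lemma _root_.IsRightExact₃.comp {C₁ : Type u₁} [Category.{v₁} C₁] [Preadditive C₁]
    {C₂ : Type u₂} [Category.{v₂} C₂] [Preadditive C₂]
    {C₃ : Type u₃} [Category.{v₃} C₃] [Preadditive C₃]
    {D : Type*} [Category* D] [Preadditive D]
    {E : Type*} [Category* E] [Preadditive E] (F : C₁ × C₂ × C₃ ⥤ D) (G : D ⥤ E)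
    [hF : IsRightExact₃ F] [IsRightExact G] :
    IsRightExact₃ (F ⋙ G) where
  fst Y Z := IsRightExact.comp (hF := hF.fst Y Z) _ G
  snd X Z := IsRightExact.comp (hF := hF.snd X Z) _ G
  thd X Y := IsRightExact.comp (hF := hF.thd X Y) _ G

/-- A morphism `f ⊗ g` is an epimorphism if `f ⊗ Y` and `X' ⊗ g` are. -/
lemma epi_map_of_epi {C D E : Type*} [Category* C] [Category* D] [Category* E] (F : C × D ⥤ E)
    {X X' : C} {Y Y' : D} (f : X ⟶ X') (g : Y ⟶ Y') (hf : Epi (F.map (f ×ₘ 𝟙 Y)))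
    (hg : Epi (F.map (𝟙 X' ×ₘ g))) : Epi (F.map (f ×ₘ g)) := by
  have e : F.map (f ×ₘ g) = F.map (f ×ₘ 𝟙 Y) ≫ F.map (𝟙 X' ×ₘ g) :=
    (congrArg F.map (Prod.hom_ext (Category.comp_id f).symm (Category.id_comp g).symm)).trans
      (F.map_comp _ _)
  rw [e]
  exact epi_comp _ _

instance epi_map_proj_triangle (I X Y : Freyd A) :
    Epi (H.map (proj X ×ₘ H.map (𝟙 I ×ₘ proj Y))) := by
  refine epi_map_of_epi H _ _ inferInstance ?_
  exact (descends₁ (tensorUnitL H I ⋙ tensorUnitL H X)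
    (IsRightExact.comp (tensorUnitL H I) (tensorUnitL H X))).epi Y

/-- The first factor is split off, and the other three are an instance of `descends₃`. -/
instance epi_map_proj_pentagon (X Y Z W : Freyd A) :
    Epi (H.map (proj X ×ₘ H.map (proj Y ×ₘ H.map (proj Z ×ₘ proj W)))) := by
  refine epi_map_of_epi H _ _ inferInstance ?_
  exact (descends₃ (tensorR H ⋙ tensorUnitL H X) (IsRightExact₃.comp _ _)).epi (Y, Z, W)

end Covering

end Freyd

/-! ### The extended structure on the Freyd category -/

theorem mainTheorem2 {A : Type u} [Category.{v} A] [Preadditive A] [HasZeroObject A]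
    [HasBinaryBiproducts A] :
    -- Extension of data and identities, for an arbitrary protensor product `T`
    (∀ (T : A × A ⥤ Freyd A) [IsBilinear T],
      (IsRightExact₂ (extend₂ T) ∧ Nonempty (emb₂ A ⋙ extend₂ T ≅ T)) ∧
      -- associators and the pentagon identity
      (∀ α : emb₃ A ⋙ tensorR (extend₂ T) ⟶ emb₃ A ⋙ tensorL (extend₂ T),
        Functor.whiskerLeft (emb₃ A) (hat₃ α) = α ∧
        (∀ γ : tensorR (extend₂ T) ⟶ tensorL (extend₂ T),
          Functor.whiskerLeft (emb₃ A) γ = α → γ = hat₃ α) ∧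
        ((∀ X Y Z : Freyd A, IsIso (assocAt (hat₃ α) X Y Z)) ↔
          ∀ a b c : A, IsIso (α.app (a, b, c))) ∧
        ((∀ X Y Z W : Freyd A, PentagonAt (hat₃ α) X Y Z W) ↔
          ∀ a b c d : A,
            PentagonAt (hat₃ α) (emb.obj a) (emb.obj b) (emb.obj c) (emb.obj d))) ∧
      -- left unitors
      (∀ (I : Freyd A) (l : emb ⋙ tensorUnitL (extend₂ T) I ⟶ emb ⋙ 𝟭 (Freyd A)),
        Functor.whiskerLeft emb (hat₁ l) = l ∧
        (∀ γ : tensorUnitL (extend₂ T) I ⟶ 𝟭 (Freyd A),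
          Functor.whiskerLeft emb γ = l → γ = hat₁ l) ∧
        ((∀ X : Freyd A, IsIso (leftAt (hat₁ l) X)) ↔ ∀ a : A, IsIso (l.app a))) ∧
      -- right unitors
      (∀ (I : Freyd A) (r : emb ⋙ tensorUnitR (extend₂ T) I ⟶ emb ⋙ 𝟭 (Freyd A)),
        Functor.whiskerLeft emb (hat₁ r) = r ∧
        (∀ γ : tensorUnitR (extend₂ T) I ⟶ 𝟭 (Freyd A),
          Functor.whiskerLeft emb γ = r → γ = hat₁ r) ∧
        ((∀ X : Freyd A, IsIso (rightAt (hat₁ r) X)) ↔ ∀ a : A, IsIso (r.app a))) ∧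
      -- the triangle identity
      (∀ (α : emb₃ A ⋙ tensorR (extend₂ T) ⟶ emb₃ A ⋙ tensorL (extend₂ T)) (I : Freyd A)
        (l : emb ⋙ tensorUnitL (extend₂ T) I ⟶ emb ⋙ 𝟭 (Freyd A))
        (r : emb ⋙ tensorUnitR (extend₂ T) I ⟶ emb ⋙ 𝟭 (Freyd A)),
        (∀ X Y : Freyd A, TriangleAt (hat₃ α) (hat₁ l) (hat₁ r) X Y) ↔
          ∀ a b : A, TriangleAt (hat₃ α) (hat₁ l) (hat₁ r) (emb.obj a) (emb.obj b)) ∧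
      -- braidings and the symmetry identity
      (∀ β : emb₂ A ⋙ extend₂ T ⟶ emb₂ A ⋙ tensorOp (extend₂ T),
        Functor.whiskerLeft (emb₂ A) (hat₂ β) = β ∧
        (∀ γ : extend₂ T ⟶ tensorOp (extend₂ T),
          Functor.whiskerLeft (emb₂ A) γ = β → γ = hat₂ β) ∧
        ((∀ X Y : Freyd A, IsIso (braidAt (hat₂ β) X Y)) ↔ ∀ a b : A, IsIso (β.app (a, b))) ∧
        ((∀ X Y : Freyd A, SymmetryAt (hat₂ β) X Y) ↔
          ∀ a b : A, β.app (a, b) ≫ β.app (b, a) = 𝟙 _)) ∧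
      -- compatibility of the braiding with the unitors
      (∀ (β : emb₂ A ⋙ extend₂ T ⟶ emb₂ A ⋙ tensorOp (extend₂ T)) (I : Freyd A)
        (l : emb ⋙ tensorUnitL (extend₂ T) I ⟶ emb ⋙ 𝟭 (Freyd A))
        (r : emb ⋙ tensorUnitR (extend₂ T) I ⟶ emb ⋙ 𝟭 (Freyd A)),
        (∀ X : Freyd A, BraidingUnitAt (hat₁ l) (hat₁ r) (hat₂ β) X) ↔
          ∀ a : A, BraidingUnitAt (hat₁ l) (hat₁ r) (hat₂ β) (emb.obj a)) ∧
      -- the hexagon identities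
      (∀ (α : emb₃ A ⋙ tensorR (extend₂ T) ≅ emb₃ A ⋙ tensorL (extend₂ T))
        (β : emb₂ A ⋙ extend₂ T ⟶ emb₂ A ⋙ tensorOp (extend₂ T)),
        ((∀ X Y Z : Freyd A, HexagonOneAt (hatIso₃ α) (hat₂ β) X Y Z) ↔
          ∀ a b c : A, HexagonOneAt (hatIso₃ α) (hat₂ β) (emb.obj a) (emb.obj b) (emb.obj c)) ∧
        ((∀ X Y Z : Freyd A, HexagonTwoAt (hatIso₃ α) (hat₂ β) X Y Z) ↔
          ∀ a b c : A, HexagonTwoAt (hatIso₃ α) (hat₂ β) (emb.obj a) (emb.obj b) (emb.obj c)) ∧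
        ((∀ X Y Z : Freyd A, HexagonOneAt' (hatIso₃ α) (hat₂ β) X Y Z) ↔
          ∀ a b c : A, HexagonOneAt' (hatIso₃ α) (hat₂ β) (emb.obj a) (emb.obj b) (emb.obj c)) ∧
        ((∀ X Y Z : Freyd A, HexagonTwoAt' (hatIso₃ α) (hat₂ β) X Y Z) ↔
          ∀ a b c : A,
            HexagonTwoAt' (hatIso₃ α) (hat₂ β) (emb.obj a) (emb.obj b) (emb.obj c)))) ∧
    -- The resulting right exact (braided, symmetric) monoidal category
    (∀ P : FPPromonoidal A, ∃ M : MonoidalCategory (Freyd A),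
      M.toMonoidalCategoryStruct = P.extStruct ∧
      (∀ X : Freyd A, IsRightExact (MonoidalCategory.tensorLeft X) ∧
        IsRightExact (MonoidalCategory.tensorRight X)) ∧
      ∀ β : P.Braiding, ∃ B : BraidedCategory (Freyd A),
        (∀ X Y : Freyd A,
          HEq (B.braiding X Y).hom (braidAt (hatIso₂ β.braid).hom X Y)) ∧
        (β.IsSymmetric → ∃ S : SymmetricCategory (Freyd A), S.toBraidedCategory = B)) := by
  refine ⟨fun T _ => ⟨⟨inferInstance, ⟨restrictExtend₂Iso T⟩⟩, fun α => ?_, fun I l => ?_,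
    fun I r => ?_, fun α I l r => ?_, fun β => ?_, fun β I l r => ?_, fun α β => ?_⟩, fun P => ?_⟩
  -- Each identity at `X, Y, …` follows from the one at `X.gen, Y.gen, …` along `proj X, proj Y, …`;
  -- the converse is the special case of objects in the image of `emb`.
  · refine ⟨(pres₃ A).whiskerLeft_extNat (exists_map_eq_pres₃ A) _ α,
      (pres₃ A).eq_extNat _ α, ?_, fun h _ _ _ _ => h _ _ _ _, fun h X Y Z W =>
        (h X.gen Y.gen Z.gen W.gen).of_epi (proj X) (proj Y) (proj Z) (proj W)⟩
    have := (pres₃ A).isIso_extNat_app_iff (exists_map_eq_pres₃ A)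
      (descends₃ _ inferInstance) (descends₃ _ inferInstance) α
    rwa [Prod.forall, Prod.forall, forall_congr' fun _ => Prod.forall,
      forall_congr' fun _ => Prod.forall] at this
  · exact ⟨(pres₁ A).whiskerLeft_extNat (exists_map_eq_pres₁ A) _ l, (pres₁ A).eq_extNat _ l,
      (pres₁ A).isIso_extNat_app_iff (exists_map_eq_pres₁ A) _ (descends₁ _ inferInstance) l⟩
  · exact ⟨(pres₁ A).whiskerLeft_extNat (exists_map_eq_pres₁ A) _ r, (pres₁ A).eq_extNat _ r,
      (pres₁ A).isIso_extNat_app_iff (exists_map_eq_pres₁ A) _ (descends₁ _ inferInstance) r⟩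
  · exact ⟨fun h _ _ => h _ _, fun h X Y => (h X.gen Y.gen).of_epi (proj X) (proj Y)⟩
  · refine ⟨whiskerLeft_hat₂ β, (pres₂ A).eq_extNat _ β, ?_, ?_⟩
    · have := (pres₂ A).isIso_extNat_app_iff (exists_map_eq_pres₂ A)
        (descends₂ _ inferInstance) (descends₂ _ inferInstance) β
      rwa [Prod.forall, Prod.forall] at this
    · exact ⟨fun h a b => (symmetryAt_hat₂_emb_iff β a b).1 (h _ _), fun h X Y =>
        ((symmetryAt_hat₂_emb_iff β X.gen Y.gen).2 (h _ _)).of_epi (proj X) (proj Y)⟩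
  · exact ⟨fun h _ => h _, fun h X => (h X.gen).of_epi (proj X)⟩
  · exact ⟨⟨fun h _ _ _ => h _ _ _, fun h X Y Z =>
        (h X.gen Y.gen Z.gen).of_epi (proj X) (proj Y) (proj Z)⟩,
      ⟨fun h _ _ _ => h _ _ _, fun h X Y Z =>
        (h X.gen Y.gen Z.gen).of_epi (proj X) (proj Y) (proj Z)⟩,
      ⟨fun h _ _ _ => h _ _ _, fun h X Y Z =>
        (h X.gen Y.gen Z.gen).of_epi (proj X) (proj Y) (proj Z)⟩,
      ⟨fun h _ _ _ => h _ _ _, fun h X Y Z =>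
        (h X.gen Y.gen Z.gen).of_epi (proj X) (proj Y) (proj Z)⟩⟩
  · have hp (X Y Z W : Freyd A) : PentagonAt (hatIso₃ P.assoc).hom X Y Z W :=
      (P.pentagon X.gen Y.gen Z.gen W.gen).of_epi (proj X) (proj Y) (proj Z) (proj W)
    have ht (X Y : Freyd A) : TriangleAt (hatIso₃ P.assoc).hom (hatIso₁ P.leftUnitor).hom
        (hatIso₁ P.rightUnitor).hom X Y :=
      (P.triangle X.gen Y.gen).of_epi (proj X) (proj Y)
    -- Tensoring with `X` on one side is, by definition, a section of `extend₂ P.tensor`.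
    refine ⟨monoidalOfCoherent _ _ _ hp ht, rfl,
      fun X => ⟨isRightExact_tensorUnitL (extend₂ P.tensor) X,
        isRightExact_tensorUnitR (extend₂ P.tensor) X⟩, fun β => ?_⟩
    have h₁ (X Y Z : Freyd A) : HexagonOneAt (hatIso₃ P.assoc) (hatIso₂ β.braid).hom X Y Z :=
      (β.hexagonOne X.gen Y.gen Z.gen).of_epi (proj X) (proj Y) (proj Z)
    have h₂ (X Y Z : Freyd A) : HexagonTwoAt (hatIso₃ P.assoc) (hatIso₂ β.braid).hom X Y Z :=
      (β.hexagonTwo X.gen Y.gen Z.gen).of_epi (proj X) (proj Y) (proj Z)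
    refine ⟨braidedOfCoherent _ _ _ hp ht _ h₁ h₂, fun X Y => HEq.rfl, fun hs => ?_⟩
    have hs' (X Y : Freyd A) : SymmetryAt (hatIso₂ β.braid).hom X Y :=
      ((symmetryAt_hat₂_emb_iff β.braid.hom X.gen Y.gen).2 (hs _ _)).of_epi (proj X) (proj Y)
    exact ⟨@SymmetricCategory.mk _ _ (monoidalOfCoherent _ _ _ hp ht)
      (braidedOfCoherent _ _ _ hp ht _ h₁ h₂) hs', rfl⟩
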